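/- Let $\{\rho\}$ be the nontrivial zeros of the Riemann zeta function $\zeta$ (the zeros with $0<\operatorname{Re}\rho<1$), counted with multiplicity, and write them in pairs as $\rho=\frac12\pm i\tau_k$ ($k=1,2,\dots$) with $\operatorname{Re}\tau_k>0$. For $n\ge 1$ put $$\mathscr Z_n=\sum_\rho\rho^{-n}:=\lim_{T\to\infty}\sum_{|\operatorname{Im}\rho|\le T}\rho^{-n},$$ for $\operatorname{Re}\sigma>\frac12$ put $Z(\sigma)=\sum_k(\tau_k^2+\frac14)^{-\sigma}$, and for $n\ge 0$ let $$\gamma_n=\lim_{M\to\infty}\Big\{\sum_{m=1}^M\frac{(\log m)^n}{m}-\frac{(\log M)^{n+1}}{n+1}\Big\}$$ be the Stieltjes constants, $\gamma=\gamma_0$ Euler's constant, and $\gamma^{\rm c}_n$ the Stieltjes cumulants, defined by the identity of formal power series $$\log\Big(1-\sum_{n=1}^\infty\frac{\gamma_{n-1}}{(n-1)!}s^n\Big)=-\sum_{n=1}^\infty\frac{\gamma^{\rm c}_{n-1}}{(n-1)!}s^n .$$ All these limits exist, the series for $Z(m)$ ($m\ge1$ an integer) and for $\mathscr Z_n$ ($n\ge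 2$) converge absolutely, and the following hold. (1) For every integer $m\ge 1$, $$Z(m)=\sum_{\ell=0}^{m-1}\binom{m+\ell-1}{m-1}\mathscr Z_{m-\ell},$$ and conversely, for every integer $n\ge 1$, $$\frac{\mathscr Z_n}{n}=\sum_{0\le\ell\le n/2}(-1)^\ell\binom{n-\ell}{\ell}\frac{Z(n-\ell)}{n-\ell}.$$ (2) For every integer $n\ge 2$, $$\mathscr Z_n=1-(-1)^n2^{-n}\zeta(n)-\frac{(\log|\zeta|)^{(n)}(0)}{(n-1)!}=1-(1-2^{-n})\zeta(n)+\frac{n}{(n-1)!}\,\gamma^{\rm c}_{n-1},$$ where $(\log|\zeta|)^{(n)}(0)$ is the $n$-th derivative at $x=0$ of the function $x\mapsto\log|\zeta(x)|$ of the real variable $x$. (3) $Z(1)=\mathscr Z_1=1+\frac{\gamma}{2}-\log 2\sqrt\pi$. -/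

import Mathlib

open Filter Topology

namespace RiemannZeros

/-- The nontrivial zeros `ρ` of the Riemann zeta function (the zeros in the critical strip). -/
def nontrivialZeros : Set ℂ :=
  {ρ | riemannZeta ρ = 0 ∧ 0 < ρ.re ∧ ρ.re < 1}

/-- The multiplicity of `ρ` as a zero of the Riemann zeta function. -/
noncomputable def mult (ρ : ℂ) : ℕ :=
  analyticOrderNatAt riemannZeta ρ

theorem finite_zeros_of_height_le (T : ℝ) :
    {ρ : ℂ | ρ ∈ nontrivialZeros ∧ |ρ.im| ≤ T}.Finite := by
  have hK : IsCompact (Set.Icc (0 : ℝ) 1 ×ℂ Set.Icc (-T) T) :=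
    isCompact_Icc.reProdIm isCompact_Icc
  refine hK.inter_riemannZetaZeros_finite.subset ?_
  rintro ρ ⟨⟨h0, h1, h2⟩, h3⟩
  refine ⟨?_, mem_riemannZetaZeros.2 h0⟩
  rw [Complex.mem_reProdIm]
  exact ⟨⟨h1.le, h2.le⟩, abs_le.1 h3⟩

/-- The finite set of nontrivial zeros `ρ` with `|Im ρ| ≤ T`. -/
noncomputable def zerosUpTo (T : ℝ) : Finset ℂ :=
  (finite_zeros_of_height_le T).toFinset

/-- `∑ ρ ^ (-n)` over the nontrivial zeros with `|Im ρ| ≤ T`, counted with multiplicity. -/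
noncomputable def partialZ (n : ℕ) (T : ℝ) : ℂ :=
  ∑ ρ ∈ zerosUpTo T, (mult ρ : ℂ) * (ρ ^ n)⁻¹

/-- `𝒵_n = ∑_ρ ρ ^ (-n)`, the zeros being grouped in pairs `ρ, 1 - ρ` (this matters only for
`n = 1`): the limit of the sums over `|Im ρ| ≤ T` as `T → ∞`. -/
noncomputable def scrZ (n : ℕ) : ℂ :=
  limUnder atTop (partialZ n)

/-- The set of values of the `τ_k`: the numbers `τ` with `Re τ > 0` such that `1/2 + i τ` is a
nontrivial zero (so that `{1/2 ± i τ_k}` is the set of nontrivial zeros). -/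
def tauSet : Set ℂ :=
  {τ | 0 < τ.re ∧ 1 / 2 + Complex.I * τ ∈ nontrivialZeros}

/-- The term of `τ` in `∑_k (τ_k ^ 2 + v) ^ (-σ)`, with the multiplicity of the zero. -/
noncomputable def zetaTerm (σ : ℂ) (v : ℝ) (τ : tauSet) : ℂ :=
  (mult (1 / 2 + Complex.I * (τ : ℂ)) : ℂ) * ((τ : ℂ) ^ 2 + (v : ℂ)) ^ (-σ)

/-- `𝒵(σ, v) = ∑_k (τ_k ^ 2 + v) ^ (-σ)`, for `Re σ > 1/2`. -/
noncomputable def hurwitzZ (σ : ℂ) (v : ℝ) : ℂ :=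
  ∑' τ : tauSet, zetaTerm σ v τ

/-- `Z(σ) = 𝒵(σ, 1/4)`. -/
noncomputable def Z (σ : ℂ) : ℂ :=
  hurwitzZ σ (1 / 4)

/-- `∑_{m = 1}^M (log m) ^ n / m - (log M) ^ (n + 1) / (n + 1)`. -/
noncomputable def stieltjesSeq (n M : ℕ) : ℝ :=
  ∑ m ∈ Finset.Icc 1 M, Real.log m ^ n / m - Real.log M ^ (n + 1) / (n + 1)

/-- The Stieltjes constants `γ_n`. -/
noncomputable def stieltjes (n : ℕ) : ℝ :=
  limUnder atTop (stieltjesSeq n)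

/-- The formal power series `∑_{n ≥ 1} γ_{n-1} / (n-1)! X ^ n`. -/
noncomputable def stieltjesSeries : PowerSeries ℝ :=
  PowerSeries.mk fun n => if n = 0 then 0 else stieltjes (n - 1) / (n - 1).factorial

/-- The Stieltjes cumulants `γ^c_n`, defined by
`log (1 - ∑_{n ≥ 1} γ_{n-1} / (n-1)! X ^ n) = - ∑_{n ≥ 1} γ^c_{n-1} / (n-1)! X ^ n`
as formal power series.  Since `- log (1 - g) = ∑_{j ≥ 1} g ^ j / j`, and `g ^ j` has no term of
degree less than `j` here, `γ^c_n / n!` is the coefficient of `X ^ (n+1)` in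
`∑_{1 ≤ j ≤ n+1} g ^ j / j`. -/
noncomputable def stieltjesCumulant (n : ℕ) : ℝ :=
  n.factorial *
    ∑ j ∈ Finset.Icc 1 (n + 1), PowerSeries.coeff (n + 1) (stieltjesSeries ^ j) / (j : ℝ)

end RiemannZeros

/-! Let `xi` be the entire function equal to s (s - 1) Λ(s) away from 0 and 1. It is invariant under
s ↦ 1 - s, and its zeros are the nontrivial zeros with the same multiplicities. The core of the
proof is 𝒵_{k+1} = -(ξ'/ξ)^{(k)}(0) / k! (`scrZ_succ`).

This is obtained without the Hadamard product. The function ξ(1/2 + w) is even and bounded by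
exp(o(R²)) on |w| ≤ R (`exists_norm_xi_le`). After its zeros in |w| ≤ R are divided out, the maximum
principle and Borel–Carathéodory show that the logarithmic derivative of the cofactor varies by o(1)
on a fixed disc, and evenness makes it vanish at 0. So ξ'/ξ and its derivatives are limits of sums
over zeros in growing discs (`tendsto_sum_zeros_iteratedDeriv_logDeriv`). To replace discs by |Im ρ|
≤ T, pair ρ with 1 - ρ: 2 ∑ 1/ρ becomes ∑ 1/(ρ(1-ρ)), whose terms have positive real part, so
convergence over discs forces absolute convergence (`summable_pairTerm_one`).

Part (1) is algebra: x = 1/ρ and y = 1/(1-ρ) satisfy x + y = xy = 1/(τ² + 1/4), and the two formulas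
express (xy)^m and x^n + y^n through each other (`mul_pow_eq_sum_choose`, `pow_add_pow_div_eq_sum`).

Parts (2) and (3) compute the derivatives of ξ'/ξ at 0. Directly at 0, a Gamma factor at 1 and ζ
itself appear. By the functional equation one may also work at 1, where ξ = s Γ_ℝ(s) · (s-1)ζ(s):
the polygamma values at 1/2 give ζ(n), and the Taylor series of (s-1)ζ(s) at 1, made of Stieltjes
constants, gives the cumulants. -/

namespace RiemannZeros

/-! ### Dividing finitely many zeros out of an entire function. -/

section Factorization

theorem exists_eq_sub_pow_mul {f : ℂ → ℂ} (hf : Differentiable ℂ f) (a : ℂ)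
    (h : analyticOrderAt f a ≠ ⊤) :
    ∃ g : ℂ → ℂ, Differentiable ℂ g ∧ g a ≠ 0 ∧
      ∀ z, f z = (z - a) ^ analyticOrderNatAt f a * g z := by
  obtain ⟨g₀, hg₀, hg₀a, hfg⟩ := ((hf.analyticAt a).analyticOrderNatAt_eq_iff h).1 rfl
  set k := analyticOrderNatAt f a
  have hne : ∀ z, z ≠ a → (z - a) ^ k ≠ 0 := fun z hz => pow_ne_zero _ (sub_ne_zero.2 hz)
  let g : ℂ → ℂ := Function.update (fun z => f z / (z - a) ^ k) a (g₀ a)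
  have hga : g =ᶠ[𝓝 a] g₀ := by
    filter_upwards [hfg] with z hz
    by_cases hza : z = a
    · simp [g, hza]
    · simp only [g, Function.update_of_ne hza, hz, smul_eq_mul]
      rw [mul_div_cancel_left₀ _ (hne z hza)]
  refine ⟨g, fun z => ?_, by simpa [g] using hg₀a, fun z => ?_⟩
  · by_cases hza : z = a
    · subst hza
      exact hga.differentiableAt_iff.2 hg₀.differentiableAt
    · have : g =ᶠ[𝓝 z] fun z => f z / (z - a) ^ k := by
        filter_upwards [isOpen_ne.mem_nhds hza] with w hw
        simp only [g, Function.update_of_ne hw]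
      refine this.differentiableAt_iff.2 ?_
      exact hf.differentiableAt.div (by fun_prop) (hne z hza)
  · by_cases hza : z = a
    · subst hza
      have := hfg.self_of_nhds
      simpa [g] using this
    · simp only [g, Function.update_of_ne hza]
      rw [mul_div_cancel₀ _ (hne z hza)]

/-- One point is removed at a time. The factors already removed do not vanish at a new point, so the
cofactor has there the same order as `f`. -/
theorem exists_eq_prod_sub_pow_mul {f : ℂ → ℂ} (hf : Differentiable ℂ f)
    (h : ∀ z, analyticOrderAt f z ≠ ⊤) (S : Finset ℂ) :
    ∃ g : ℂ → ℂ, Differentiable ℂ g ∧ (∀ a ∈ S, g a ≠ 0) ∧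
      ∀ z, f z = (∏ a ∈ S, (z - a) ^ analyticOrderNatAt f a) * g z := by
  classical
  induction S using Finset.induction_on with
  | empty => exact ⟨f, hf, by simp, by simp⟩
  | insert a S ha ih =>
    obtain ⟨g, hg, hgS, hfg⟩ := ih
    let P : ℂ → ℂ := fun z => ∏ a ∈ S, (z - a) ^ analyticOrderNatAt f a
    have hP : Differentiable ℂ P := by
      intro z
      exact DifferentiableAt.fun_finsetProd fun i _ => by fun_prop
    have hPa : P a ≠ 0 := Finset.prod_ne_zero_iff.2 fun b hb =>
      pow_ne_zero _ (sub_ne_zero.2 fun h => ha (h ▸ hb))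
    have hord : analyticOrderAt f a = analyticOrderAt g a := by
      have : f = P * g := funext hfg
      conv_lhs => rw [this]
      rw [analyticOrderAt_mul (hP.analyticAt a) (hg.analyticAt a),
        (hP.analyticAt a).analyticOrderAt_eq_zero.2 hPa, zero_add]
    have hnat : analyticOrderNatAt g a = analyticOrderNatAt f a := by
      simp [analyticOrderNatAt, hord]
    obtain ⟨g', hg', hg'a, hgg'⟩ := exists_eq_sub_pow_mul hg a (hord ▸ h a)
    rw [hnat] at hgg'
    refine ⟨g', hg', ?_, fun z => ?_⟩
    · intro b hb
      rcases Finset.mem_insert.1 hb with rfl | hb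
      · exact hg'a
      · have := hgS b hb
        rw [hgg'] at this
        exact right_ne_zero_of_mul this
    · rw [hfg, hgg', Finset.prod_insert ha]
      ring

end Factorization

/-! ### Derivatives of locally uniform limits. -/

section LocallyUniform

theorem tendsto_iteratedDeriv_of_tendstoLocallyUniformlyOn {U : Set ℂ} (hU : IsOpen U)
    {F : ℕ → ℂ → ℂ} {f : ℂ → ℂ} (h : TendstoLocallyUniformlyOn F f atTop U)
    (hF : ∀ n, DifferentiableOn ℂ (F n) U) (k : ℕ) {z : ℂ} (hz : z ∈ U) :
    Tendsto (fun n => iteratedDeriv k (F n) z) atTop (𝓝 (iteratedDeriv k f z)) := by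
  induction k generalizing F f with
  | zero => simpa using h.tendsto_at hz
  | succ k ih =>
    simp only [iteratedDeriv_succ']
    exact ih (h.deriv (Eventually.of_forall hF) hU) fun n => (hF n).deriv hU

end LocallyUniform

/-! ### Higher derivatives of logarithmic derivatives. -/

section LogDeriv

theorem analyticAt_logDeriv {f : ℂ → ℂ} {z : ℂ} (hf : AnalyticAt ℂ f z) (hz : f z ≠ 0) :
    AnalyticAt ℂ (logDeriv f) z := hf.deriv.div hf hz

theorem iteratedDeriv_logDeriv_mul {f g : ℂ → ℂ} {z : ℂ} (hf : AnalyticAt ℂ f z)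
    (hg : AnalyticAt ℂ g z) (hfz : f z ≠ 0) (hgz : g z ≠ 0) (n : ℕ) :
    iteratedDeriv n (logDeriv fun w => f w * g w) z =
      iteratedDeriv n (logDeriv f) z + iteratedDeriv n (logDeriv g) z := by
  have h1 : (logDeriv fun w => f w * g w) =ᶠ[𝓝 z] logDeriv f + logDeriv g := by
    filter_upwards [hf.continuousAt.eventually_ne hfz, hg.continuousAt.eventually_ne hgz,
      hf.eventually_analyticAt, hg.eventually_analyticAt] with w h1 h2 h3 h4
    exact logDeriv_mul w h1 h2 h3.differentiableAt h4.differentiableAt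
  rw [h1.iteratedDeriv_eq, iteratedDeriv_add (analyticAt_logDeriv hf hfz).contDiffAt
    (analyticAt_logDeriv hg hgz).contDiffAt]

theorem iteratedDeriv_sub_inv (n : ℕ) (a z : ℂ) :
    iteratedDeriv n (fun w => (w - a)⁻¹) z = (-1) ^ n * n.factorial * ((z - a) ^ (n + 1))⁻¹ := by
  have := congrFun (iter_deriv_inv_linear_sub n (1 : ℂ) a) z
  simp only [one_mul, one_pow, mul_one] at this
  rw [iteratedDeriv_eq_iterate, this, show (-1 - n : ℤ) = -((n + 1 : ℕ) : ℤ) by push_cast; ring,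
    zpow_neg, zpow_natCast]

theorem iteratedDeriv_comp_affine {g : ℂ → ℂ} {a b z : ℂ} (n : ℕ)
    (hg : AnalyticAt ℂ g (a * z + b)) :
    iteratedDeriv n (fun w => g (a * w + b)) z = a ^ n * iteratedDeriv n g (a * z + b) := by
  induction n generalizing g with
  | zero => simp
  | succ n ih =>
    have hc : Tendsto (fun w => a * w + b) (𝓝 z) (𝓝 (a * z + b)) :=
      Continuous.tendsto (by fun_prop) z
    have h1 : deriv (fun w => g (a * w + b)) =ᶠ[𝓝 z] fun w => a * deriv g (a * w + b) := by
      filter_upwards [hc.eventually hg.eventually_analyticAt] with w hw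
      have : HasDerivAt (fun w => g (a * w + b)) (deriv g (a * w + b) * a) w :=
        hw.differentiableAt.hasDerivAt.comp w
          (by simpa using ((hasDerivAt_id w).const_mul a).add_const b)
      rw [this.deriv, mul_comm]
    rw [iteratedDeriv_succ', h1.iteratedDeriv_eq, iteratedDeriv_const_mul_field, ih hg.deriv,
      iteratedDeriv_succ']
    ring

/-- Every change of variable below (the reflection s ↦ 1 - s, the shift by 1/2, the doubling for Γ)
goes through this lemma, hence literal shapes such as `1 * z + 1` or `2 * s + 0` later on. -/
theorem iteratedDeriv_logDeriv_comp_affine {f : ℂ → ℂ} {a b z : ℂ} (n : ℕ)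
    (hf : AnalyticAt ℂ f (a * z + b)) (hz : f (a * z + b) ≠ 0) :
    iteratedDeriv n (logDeriv fun w => f (a * w + b)) z =
      a ^ (n + 1) * iteratedDeriv n (logDeriv f) (a * z + b) := by
  have h1 : (logDeriv fun w => f (a * w + b)) =ᶠ[𝓝 z] fun w => a * logDeriv f (a * w + b) := by
    have hc : Tendsto (fun w => a * w + b) (𝓝 z) (𝓝 (a * z + b)) :=
      Continuous.tendsto (by fun_prop) z
    filter_upwards [hc.eventually hf.eventually_analyticAt] with w hw
    rw [logDeriv_apply, logDeriv_apply]
    have : HasDerivAt (fun w => f (a * w + b)) (deriv f (a * w + b) * a) w :=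
      hw.differentiableAt.hasDerivAt.comp w
        (by simpa using ((hasDerivAt_id w).const_mul a).add_const b)
    rw [this.deriv]
    ring
  rw [h1.iteratedDeriv_eq, iteratedDeriv_const_mul_field,
    iteratedDeriv_comp_affine n (analyticAt_logDeriv hf hz)]
  ring

end LogDeriv

/-! ### Logarithmic derivative of an even entire function as a sum over zeros in discs. -/

section EvenEntire

open Metric Set

/-- On the disc g = g(0) e^h with h(0) = 0, h' = g'/g and Re h ≤ M. Borel–Carathéodory gives |h| ≤
2M on |w| ≤ R/2, and Cauchy's estimate with radius R/4 gives |h''| ≤ 2! · 2M / (R/4)² = 64M/R². The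
mean value inequality then bounds the variation of h'. -/
theorem norm_logDeriv_sub_le {g : ℂ → ℂ} (hg : Differentiable ℂ g) {R M : ℝ} (hR : 0 < R)
    (hM : 0 < M) (hg0 : ∀ w ∈ closedBall (0 : ℂ) R, g w ≠ 0)
    (hgM : ∀ w ∈ closedBall (0 : ℂ) R, ‖g w‖ ≤ Real.exp M * ‖g 0‖) {w : ℂ} (hw : ‖w‖ ≤ R / 4) :
    ‖logDeriv g w - logDeriv g 0‖ ≤ 64 * M / R ^ 2 * ‖w‖ := by
  have hne : ∀ w ∈ ball (0 : ℂ) R, g w ≠ 0 := fun w hw => hg0 w (ball_subset_closedBall hw)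
  have hl : DifferentiableOn ℂ (logDeriv g) (ball 0 R) := fun w hw =>
    (analyticAt_logDeriv (hg.analyticAt w) (hne w hw)).differentiableAt.differentiableWithinAt
  obtain ⟨h, hh0, hh⟩ := hl.isExactOn_ball.with_val_at 0 0
  have hhd : DifferentiableOn ℂ h (ball 0 R) := fun w hw =>
    (hh w hw).differentiableAt.differentiableWithinAt
  have hexp : ∀ w ∈ ball (0 : ℂ) R, g w * Complex.exp (-h w) = g 0 := by
    intro w hw
    have hd : ∀ x ∈ ball (0 : ℂ) R, HasDerivAt (fun w => g w * Complex.exp (-h w)) 0 x := by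
      intro x hx
      have := (hg x).hasDerivAt.mul (hh x hx).neg.cexp
      refine this.congr_deriv ?_
      rw [logDeriv_apply]
      field_simp [hne x hx]
      ring
    have := (convex_ball (0 : ℂ) R).is_const_of_fderivWithin_eq_zero (𝕜 := ℂ)
      (f := fun w => g w * Complex.exp (-h w))
      (fun x hx => (hd x hx).differentiableAt.differentiableWithinAt)
      (fun x hx => by
        rw [fderivWithin_of_isOpen isOpen_ball hx]
        ext
        simpa using (hd x hx).deriv) hw (mem_ball_self hR)
    simpa [hh0] using this
  have hg00 : 0 < ‖g 0‖ := norm_pos_iff.2 (hne 0 (mem_ball_self hR))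
  have hre : MapsTo h (ball 0 R) {z | z.re ≤ M} := by
    intro w hw
    have h1 := hgM w (ball_subset_closedBall hw)
    rw [← hexp w hw, norm_mul, Complex.norm_exp, Complex.neg_re] at h1
    have h2 : 0 < ‖g w‖ := norm_pos_iff.2 (hne w hw)
    have h3 : 1 ≤ Real.exp (M + -(h w).re) := by
      rw [Real.exp_add]
      by_contra! hlt
      nlinarith
    have := Real.one_le_exp_iff.1 h3
    show (h w).re ≤ M
    linarith
  have hbound : ∀ w : ℂ, ‖w‖ ≤ R / 2 → ‖h w‖ ≤ 2 * M := by
    intro w hw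
    have := Complex.borelCaratheodory_zero hM hhd hre hR (z := w)
      (mem_ball_zero_iff.2 (by linarith)) hh0
    refine this.trans ?_
    rw [div_le_iff₀ (by linarith)]
    nlinarith
  have hder : ∀ w ∈ closedBall (0 : ℂ) (R / 4), ‖deriv (logDeriv g) w‖ ≤ 64 * M / R ^ 2 := by
    intro w hw
    have hw' : ‖w‖ ≤ R / 4 := mem_closedBall_zero_iff.1 hw
    have hwb : w ∈ ball (0 : ℂ) R := mem_ball_zero_iff.2 (by linarith)
    have heq : deriv h =ᶠ[𝓝 w] logDeriv g := by
      filter_upwards [isOpen_ball.mem_nhds hwb] with x hx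
      exact (hh x hx).deriv
    have h2 : iteratedDeriv 2 h w = deriv (logDeriv g) w := by
      rw [iteratedDeriv_succ, iteratedDeriv_one]
      exact heq.deriv_eq
    have hsub : closedBall w (R / 4) ⊆ closedBall (0 : ℂ) (R / 2) := by
      intro x hx
      rw [mem_closedBall, dist_eq_norm] at hx
      rw [mem_closedBall_zero_iff]
      calc ‖x‖ = ‖(x - w) + w‖ := by ring_nf
        _ ≤ _ := (norm_add_le _ _).trans (by linarith)
    have hd : DiffContOnCl ℂ h (ball w (R / 4)) := by
      refine (hhd.mono ?_).diffContOnCl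
      rw [closure_ball _ (by positivity)]
      exact hsub.trans (closedBall_subset_ball (by linarith))
    have := Complex.norm_iteratedDeriv_le_of_forall_mem_sphere_norm_le 2 (by positivity) hd
      (fun z hz => hbound z (mem_closedBall_zero_iff.1 (hsub (sphere_subset_closedBall hz))))
    rw [h2] at this
    refine this.trans (le_of_eq ?_)
    norm_num [Nat.factorial]
    field_simp
    norm_num
  have := (convex_closedBall (0 : ℂ) (R / 4)).norm_image_sub_le_of_norm_deriv_le
    (f := logDeriv g) (x := 0) (y := w)
    (fun x hx => (hl.differentiableAt (isOpen_ball.mem_nhds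
      (closedBall_subset_ball (by linarith) hx))))
    hder (mem_closedBall_self (by positivity)) (mem_closedBall_zero_iff.2 hw)
  simpa using this

/-- On |z| = 2R each |z - a| is at least R ≥ |a|, so the polynomial factor is at least as large in
modulus at z as at 0. This bounds |g(z)| on the circle, and the maximum principle carries the bound
inside. -/
theorem norm_cofactor_le {f g : ℂ → ℂ} (hg : Differentiable ℂ g) (S : Finset ℂ) (k : ℂ → ℕ)
    (hfg : ∀ z, f z = (∏ a ∈ S, (z - a) ^ k a) * g z) (h0 : f 0 ≠ 0) {R B : ℝ} (hR : 0 < R)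
    (hS : ∀ a ∈ S, ‖a‖ ≤ R) (hB : ∀ w, ‖w‖ ≤ 2 * R → ‖f w‖ ≤ B) {w : ℂ} (hw : ‖w‖ ≤ 2 * R) :
    ‖g w‖ ≤ B / ‖f 0‖ * ‖g 0‖ := by
  have hf0 : 0 < ‖f 0‖ := norm_pos_iff.2 h0
  have hfr : ∀ z ∈ frontier (ball (0 : ℂ) (2 * R)), ‖g z‖ ≤ B / ‖f 0‖ * ‖g 0‖ := by
    intro z hz
    rw [frontier_ball _ (by positivity), mem_sphere_zero_iff_norm] at hz
    have h1 := congrArg norm (hfg z)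
    have h2 := congrArg norm (hfg 0)
    rw [norm_mul, norm_prod] at h1 h2
    have h3 : ∏ a ∈ S, ‖(0 - a) ^ k a‖ ≤ ∏ a ∈ S, ‖(z - a) ^ k a‖ := by
      refine Finset.prod_le_prod (fun _ _ => norm_nonneg _) fun a ha => ?_
      rw [norm_pow, norm_pow]
      refine pow_le_pow_left₀ (norm_nonneg _) ?_ _
      rw [zero_sub, norm_neg]
      have := norm_sub_norm_le z a
      linarith [hS a ha]
    rw [div_mul_eq_mul_div, le_div_iff₀ hf0]
    calc ‖g z‖ * ‖f 0‖ = ‖g z‖ * ‖g 0‖ * ∏ a ∈ S, ‖(0 - a) ^ k a‖ := by rw [h2]; ring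
      _ ≤ ‖g z‖ * ‖g 0‖ * ∏ a ∈ S, ‖(z - a) ^ k a‖ := by gcongr
      _ = ‖f z‖ * ‖g 0‖ := by rw [h1]; ring
      _ ≤ B * ‖g 0‖ := by gcongr; exact hB z hz.le
  refine Complex.norm_le_of_forall_mem_frontier_norm_le isBounded_ball hg.diffContOnCl hfr ?_
  rw [closure_ball _ (by positivity)]
  exact mem_closedBall_zero_iff.2 hw

theorem analyticOrderAt_comp_affine {f : ℂ → ℂ} (a b z : ℂ) (ha : a ≠ 0) :
    analyticOrderAt (fun w => f (a * w + b)) z = analyticOrderAt f (a * z + b) := by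
  have hd : HasDerivAt (fun w : ℂ => a * w + b) a z := by
    simpa using ((hasDerivAt_id z).const_mul a).add_const b
  exact analyticOrderAt_comp_of_deriv_ne_zero (f := f) (g := fun w : ℂ => a * w + b) (z₀ := z)
    (by fun_prop) (by rw [hd.deriv]; exact ha)

theorem analyticOrderAt_ne_top_of_entire {f : ℂ → ℂ} (hf : Differentiable ℂ f) {z₀ : ℂ}
    (h : f z₀ ≠ 0) (z : ℂ) : analyticOrderAt f z ≠ ⊤ := by
  have ha : AnalyticOnNhd ℂ f univ := fun z _ => hf.analyticAt z
  refine ha.analyticOrderAt_ne_top_of_isPreconnected isPreconnected_univ (mem_univ z₀)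
    (mem_univ z) ?_
  rw [((hf.analyticAt z₀).analyticOrderAt_eq_zero).2 h]
  simp

theorem logDeriv_prod_sub_pow_mul {f g : ℂ → ℂ} (hg : Differentiable ℂ g) (S : Finset ℂ)
    (k : ℂ → ℕ) (hfg : ∀ z, f z = (∏ a ∈ S, (z - a) ^ k a) * g z) {w : ℂ} (hw : w ∉ S)
    (hgw : g w ≠ 0) :
    logDeriv f w = ∑ a ∈ S, (k a : ℂ) * (w - a)⁻¹ + logDeriv g w := by
  have hne : ∀ a ∈ S, (w - a) ^ k a ≠ 0 := fun a ha =>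
    pow_ne_zero _ (sub_ne_zero.2 fun h => hw (h ▸ ha))
  rw [show f = fun z => (∏ a ∈ S, (z - a) ^ k a) * g z from funext hfg,
    logDeriv_mul w (Finset.prod_ne_zero_iff.2 hne) hgw
      (DifferentiableAt.fun_finsetProd fun i _ => by fun_prop) (hg w),
    logDeriv_prod hne (fun i _ => by fun_prop)]
  congr 1
  refine Finset.sum_congr rfl fun a _ => ?_
  rw [logDeriv_fun_pow (by fun_prop)]
  simp [logDeriv_apply]

/-- The difference between f'/f and the sum over the zeros in |a| ≤ R is the logarithmic derivative
of the cofactor. It is zero at the origin by evenness, and O(B(2R)/R²) + O(1/R²) near `z₀`. Cauchy's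
estimate transfers this to the derivatives. -/
theorem tendsto_sum_zeros_iteratedDeriv_logDeriv {f : ℂ → ℂ} (hf : Differentiable ℂ f)
    (heven : ∀ w, f (-w) = f w) (h0 : f 0 ≠ 0) {B : ℝ → ℝ}
    (hB : ∀ R, 1 ≤ R → ∀ w, ‖w‖ ≤ R → ‖f w‖ ≤ Real.exp (B R))
    (hB' : Tendsto (fun R => B R / R ^ 2) atTop (𝓝 0))
    (S : ℝ → Finset ℂ) (hS : ∀ R a, a ∈ S R ↔ f a = 0 ∧ ‖a‖ ≤ R) (n : ℕ) {z₀ : ℂ}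
    (hz₀ : f z₀ ≠ 0) :
    Tendsto (fun R => ∑ a ∈ S R, (analyticOrderNatAt f a : ℂ) *
      ((-1) ^ n * n.factorial * ((z₀ - a) ^ (n + 1))⁻¹)) atTop
      (𝓝 (iteratedDeriv n (logDeriv f) z₀)) := by
  have hord := analyticOrderAt_ne_top_of_entire hf h0
  choose g hg hgS hfg using fun R => exists_eq_prod_sub_pow_mul hf hord (S R)
  have hnot : ∀ R w, f w ≠ 0 → w ∉ S R := fun R w hw h => hw ((hS R w).1 h).1
  have hgne : ∀ R w, f w ≠ 0 → g R w ≠ 0 := fun R w hw h => hw (by rw [hfg R, h, mul_zero])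
  have hneg : ∀ a, analyticOrderNatAt f (-a) = analyticOrderNatAt f a := by
    intro a
    have := analyticOrderAt_comp_affine (f := f) (-1) 0 a (by norm_num)
    simp only [neg_mul, one_mul, add_zero, heven] at this
    simp only [analyticOrderNatAt, ← this]
  -- The logarithmic derivative of an even function vanishes at 0, and so does the sum over the
  -- symmetric set `S R`.
  have hl0 : ∀ R, logDeriv (g R) 0 = 0 := by
    intro R
    have h1 := logDeriv_prod_sub_pow_mul (hg R) (S R) _ (hfg R) (hnot R 0 h0) (hgne R 0 h0)
    have h2 : logDeriv f 0 = 0 := by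
      have h3 : deriv (fun w => f (-w)) 0 = -deriv f 0 := by simp [deriv_comp_neg]
      simp only [heven] at h3
      rw [logDeriv_apply, show deriv f 0 = 0 from by linear_combination h3 / 2, zero_div]
    have h4 : ∑ a ∈ S R, (analyticOrderNatAt f a : ℂ) * (0 - a)⁻¹ =
        -∑ a ∈ S R, (analyticOrderNatAt f a : ℂ) * (0 - a)⁻¹ := by
      rw [← Finset.sum_neg_distrib]
      refine Finset.sum_nbij' (fun a => -a) (fun a => -a) ?_ ?_ (by simp) (by simp) ?_
      · intro a ha; rw [hS] at ha ⊢; simpa [heven] using ha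
      · intro a ha; rw [hS] at ha ⊢; simpa [heven] using ha
      · intro a _
        rw [hneg]
        simp [inv_neg]
    rw [h2] at h1
    linear_combination -h1 - h4 / 2
  -- Chosen so that exp(B(2R)) / |f(0)| ≤ exp(M R), with the 1 ensuring positivity.
  set M : ℝ → ℝ := fun R => |B (2 * R)| + |Real.log ‖f 0‖| + 1 with hMdef
  have hMpos : ∀ R, 0 < M R := fun R => by positivity
  have hbound : ∀ R, 1 ≤ R → ∀ w : ℂ, ‖w‖ ≤ R / 4 →
      ‖logDeriv (g R) w‖ ≤ 64 * M R / R ^ 2 * ‖w‖ := by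
    intro R hR w hw
    have := norm_logDeriv_sub_le (hg R) (R := R) (M := M R) (by linarith) (hMpos R) ?_ ?_ hw
    · simpa [hl0] using this
    · intro w hw hgw
      refine hgS R w ((hS R w).2 ⟨by rw [hfg R, hgw, mul_zero], ?_⟩) hgw
      exact mem_closedBall_zero_iff.1 hw
    · intro w hw
      have hw : ‖w‖ ≤ R := mem_closedBall_zero_iff.1 hw
      have hf0 : 0 < ‖f 0‖ := norm_pos_iff.2 h0
      refine (norm_cofactor_le (hg R) (S R) _ (hfg R) h0 (R := R) (by linarith)
        (fun a ha => ((hS R a).1 ha).2) (hB (2 * R) (by linarith))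
        (hw.trans (by linarith))).trans ?_
      gcongr
      rw [div_le_iff₀ hf0]
      nth_rewrite 1 [← Real.exp_log hf0]
      rw [← Real.exp_add, Real.exp_le_exp]
      have h1 := le_abs_self (B (2 * R))
      have h2 := neg_abs_le (Real.log ‖f 0‖)
      simp only [hMdef]
      linarith
  have hlim : Tendsto (fun R => n.factorial * (64 * M R / R ^ 2 * (‖z₀‖ + 1))) atTop (𝓝 0) := by
    have h1 : Tendsto (fun R : ℝ => B (2 * R) / (2 * R) ^ 2) atTop (𝓝 0) :=
      hB'.comp (tendsto_id.const_mul_atTop (by norm_num : (0 : ℝ) < 2))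
    have h2 : Tendsto (fun R : ℝ => (R ^ 2)⁻¹) atTop (𝓝 0) :=
      tendsto_inv_atTop_zero.comp (tendsto_pow_atTop (by norm_num))
    have h3 : Tendsto (fun R : ℝ => n.factorial * (64 * (4 * |B (2 * R) / (2 * R) ^ 2| +
        (|Real.log ‖f 0‖| + 1) * (R ^ 2)⁻¹) * (‖z₀‖ + 1))) atTop
        (𝓝 (n.factorial * (64 * (4 * |0| +
        (|Real.log ‖f 0‖| + 1) * 0) * (‖z₀‖ + 1)))) :=
      (((h1.abs.const_mul 4).add (h2.const_mul _)).const_mul 64 |>.mul_const _).const_mul _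
    simp only [abs_zero, mul_zero, add_zero, zero_mul] at h3
    refine h3.congr' ?_
    filter_upwards [eventually_gt_atTop 0] with R hR
    simp only [hMdef]
    rw [abs_div, abs_of_pos (by positivity : 0 < (2 * R) ^ 2)]
    field_simp
    ring
  have hrem : Tendsto (fun R => iteratedDeriv n (logDeriv (g R)) z₀) atTop (𝓝 0) := by
    refine squeeze_zero_norm' ?_ hlim
    -- From here on the unit disc about `z₀` lies in |w| ≤ R/4, where `hbound` applies.
    filter_upwards [eventually_ge_atTop (4 * (‖z₀‖ + 1))] with R hR
    have hR1 : 1 ≤ R := by linarith [norm_nonneg z₀]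
    have hin : ∀ x ∈ closedBall z₀ 1, ‖x‖ ≤ ‖z₀‖ + 1 := by
      intro x hx
      rw [mem_closedBall, dist_eq_norm] at hx
      linarith [norm_sub_norm_le x z₀]
    have hd : DiffContOnCl ℂ (logDeriv (g R)) (ball z₀ 1) := by
      refine DifferentiableOn.diffContOnCl fun x hx => ?_
      rw [closure_ball _ one_ne_zero] at hx
      refine (analyticAt_logDeriv ((hg R).analyticAt x)
        fun hgx => ?_).differentiableAt.differentiableWithinAt
      exact hgS R x ((hS R x).2 ⟨by rw [hfg R, hgx, mul_zero], (hin x hx).trans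
        (by linarith [norm_nonneg z₀])⟩) hgx
    have := Complex.norm_iteratedDeriv_le_of_forall_mem_sphere_norm_le n one_pos hd
      (C := 64 * M R / R ^ 2 * (‖z₀‖ + 1)) fun z hz => by
        have hz' := hin z (sphere_subset_closedBall hz)
        refine (hbound R hR1 z (by linarith)).trans ?_
        have := hMpos R
        gcongr
    simpa using this
  have hsplit : ∀ R, ∑ a ∈ S R, (analyticOrderNatAt f a : ℂ) *
      ((-1) ^ n * n.factorial * ((z₀ - a) ^ (n + 1))⁻¹) =
      iteratedDeriv n (logDeriv f) z₀ - iteratedDeriv n (logDeriv (g R)) z₀ := by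
    intro R
    have h1 : logDeriv f =ᶠ[𝓝 z₀] (fun w => ∑ a ∈ S R, (analyticOrderNatAt f a : ℂ) * (w - a)⁻¹) +
        logDeriv (g R) := by
      filter_upwards [hf.continuous.continuousAt.eventually_ne hz₀] with w hw
      exact logDeriv_prod_sub_pow_mul (hg R) (S R) _ (hfg R) (hnot R w hw) (hgne R w hw)
    have h2 : ∀ a ∈ S R, AnalyticAt ℂ (fun w => (analyticOrderNatAt f a : ℂ) * (w - a)⁻¹) z₀ :=
      fun a ha => analyticAt_const.mul ((by fun_prop : AnalyticAt ℂ (fun w => w - a) z₀).inv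
        (sub_ne_zero.2 fun h => hnot R z₀ hz₀ (h ▸ ha)))
    rw [h1.iteratedDeriv_eq, iteratedDeriv_add
      (ContDiffAt.sum fun a ha => (h2 a ha).contDiffAt)
      (analyticAt_logDeriv ((hg R).analyticAt z₀) (hgne R z₀ hz₀)).contDiffAt,
      iteratedDeriv_fun_sum fun a ha => (h2 a ha).contDiffAt]
    simp only [iteratedDeriv_const_mul_field, iteratedDeriv_sub_inv]
    ring
  simp only [hsplit]
  simpa using tendsto_const_nhds.sub hrem

end EvenEntire

/-! ### The entire function ξ, its functional equation and its zeros. -/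

section Xi

open Complex

/-- Riemann's entire function `s (s - 1) Λ(s)`. -/
noncomputable def xi (s : ℂ) : ℂ := s * (s - 1) * completedRiemannZeta₀ s + 1

theorem differentiable_xi : Differentiable ℂ xi := by
  unfold xi
  exact ((differentiable_id.mul (differentiable_id.sub_const 1)).mul
    differentiable_completedZeta₀).add_const 1

theorem xi_one_sub (s : ℂ) : xi (1 - s) = xi s := by
  simp only [xi, completedRiemannZeta₀_one_sub]
  ring

theorem xi_zero : xi 0 = 1 := by simp [xi]

theorem xi_one : xi 1 = 1 := by simp [xi]

theorem xi_eq {s : ℂ} (h0 : s ≠ 0) (h1 : s ≠ 1) :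
    xi s = s * (s - 1) * completedRiemannZeta s := by
  have : (1 - s) ≠ 0 := sub_ne_zero.2 h1.symm
  rw [xi, completedRiemannZeta_eq]
  field_simp
  ring

theorem riemannZeta_eq_xi {s : ℂ} (h0 : s ≠ 0) (h1 : s ≠ 1) :
    riemannZeta s = xi s * ((s * (s - 1))⁻¹ * (Gammaℝ s)⁻¹) := by
  have : (s - 1) ≠ 0 := sub_ne_zero.2 h1
  rw [riemannZeta_def_of_ne_zero h0, xi_eq h0 h1]
  field_simp

theorem xi_eq_zero_iff_of_re_pos {s : ℂ} (hs : 0 < s.re) (h1 : s ≠ 1) :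
    xi s = 0 ↔ riemannZeta s = 0 := by
  have h0 : s ≠ 0 := by rintro rfl; simp at hs
  have : (s - 1) ≠ 0 := sub_ne_zero.2 h1
  rw [riemannZeta_eq_xi h0 h1]
  simp [h0, this, Gammaℝ_ne_zero_of_re_pos hs]

theorem xi_ne_zero_of_one_le_re {s : ℂ} (hs : 1 ≤ s.re) : xi s ≠ 0 := by
  by_cases h1 : s = 1
  · simp [h1, xi_one]
  · rw [Ne, xi_eq_zero_iff_of_re_pos (by linarith) h1]
    exact riemannZeta_ne_zero_of_one_le_re hs

/-- Nonvanishing of ζ on Re s ≥ 1 excludes that half-plane, and the functional equation excludes Re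
s ≤ 0. In the strip ξ and ζ differ by a nonvanishing factor. -/
theorem xi_eq_zero_iff (s : ℂ) : xi s = 0 ↔ s ∈ nontrivialZeros := by
  constructor
  · intro h
    have hlt : s.re < 1 := by
      by_contra! hs
      exact xi_ne_zero_of_one_le_re hs h
    have hpos : 0 < s.re := by
      by_contra! hs
      rw [← xi_one_sub] at h
      exact xi_ne_zero_of_one_le_re (by simpa using hs) h
    exact ⟨(xi_eq_zero_iff_of_re_pos hpos (by rintro rfl; simp at hlt)).1 h, hpos, hlt⟩
  · rintro ⟨h, hpos, hlt⟩
    exact (xi_eq_zero_iff_of_re_pos hpos (by rintro rfl; simp at hlt)).2 h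

theorem one_sub_mem_nontrivialZeros {s : ℂ} (hs : s ∈ nontrivialZeros) :
    1 - s ∈ nontrivialZeros := by
  rwa [← xi_eq_zero_iff, xi_one_sub, xi_eq_zero_iff]

theorem analyticOrderAt_xi {s : ℂ} (hs : s ∈ nontrivialZeros) :
    analyticOrderAt xi s = analyticOrderAt riemannZeta s := by
  obtain ⟨-, hpos, hlt⟩ := hs
  have h0 : s ≠ 0 := by rintro rfl; simp at hpos
  have h1 : s ≠ 1 := by rintro rfl; simp at hlt
  have h1' : s - 1 ≠ 0 := sub_ne_zero.2 h1
  have hG : AnalyticAt ℂ (fun s => (s * (s - 1))⁻¹ * (Gammaℝ s)⁻¹) s :=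
    ((by fun_prop : AnalyticAt ℂ (fun s : ℂ => s * (s - 1)) s).inv (mul_ne_zero h0 h1')).mul
      (differentiable_Gammaℝ_inv.analyticAt s)
  have heq : riemannZeta =ᶠ[𝓝 s] xi * fun s => (s * (s - 1))⁻¹ * (Gammaℝ s)⁻¹ := by
    filter_upwards [isOpen_ne.mem_nhds h0, isOpen_ne.mem_nhds h1] with w hw0 hw1
    exact riemannZeta_eq_xi hw0 hw1
  rw [analyticOrderAt_congr heq, analyticOrderAt_mul (differentiable_xi.analyticAt s) hG,
    hG.analyticOrderAt_eq_zero.2, add_zero]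
  simp [h0, h1', Gammaℝ_ne_zero_of_re_pos hpos]

theorem analyticOrderNatAt_xi {s : ℂ} (hs : s ∈ nontrivialZeros) :
    analyticOrderNatAt xi s = mult s := by
  simp [mult, analyticOrderNatAt, analyticOrderAt_xi hs]

theorem mult_one_sub {s : ℂ} (hs : s ∈ nontrivialZeros) : mult (1 - s) = mult s := by
  rw [← analyticOrderNatAt_xi hs, ← analyticOrderNatAt_xi (one_sub_mem_nontrivialZeros hs)]
  have := analyticOrderAt_comp_affine (f := xi) (-1) 1 s (by norm_num)
  have h2 : (fun w => xi (-1 * w + 1)) = xi := by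
    ext w; rw [← xi_one_sub]; ring_nf
  rw [h2, show -1 * s + 1 = 1 - s by ring] at this
  simp [analyticOrderNatAt, this]

end Xi

/-! ### Growth of ξ: log |ξ| is O(R^{3/2}). -/

section Growth

open Complex MeasureTheory Set

/-- For a ≤ Re s ≤ b, |t^{s-1}| is at most t^{a-1} when t ≤ 1 and at most t^{b-1} when t ≥ 1, so the
sum of the two integrands at the edges dominates. -/
theorem exists_norm_mellin_le {f : ℝ → ℂ} {a b : ℝ} (ha : MellinConvergent f a)
    (hb : MellinConvergent f b) :
    ∃ K, ∀ s : ℂ, a ≤ s.re → s.re ≤ b → ‖mellin f s‖ ≤ K := by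
  refine ⟨∫ t in Ioi (0 : ℝ), (‖(t : ℂ) ^ ((a : ℂ) - 1) • f t‖ + ‖(t : ℂ) ^ ((b : ℂ) - 1) • f t‖),
    fun s hsa hsb => norm_integral_le_of_norm_le (ha.norm.add hb.norm) ?_⟩
  filter_upwards [ae_restrict_mem measurableSet_Ioi] with t (ht : 0 < t)
  simp only [norm_smul, norm_cpow_eq_rpow_re_of_pos ht, ← add_mul]
  gcongr
  simp only [sub_re, ofReal_re, one_re]
  rcases le_total t 1 with h | h
  · have := Real.rpow_le_rpow_of_exponent_ge ht h (sub_le_sub_right hsa 1)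
    have h2 := Real.rpow_nonneg ht.le (b - 1)
    linarith
  · have := Real.rpow_le_rpow_of_exponent_le h (sub_le_sub_right hsb 1)
    have h2 := Real.rpow_nonneg ht.le (a - 1)
    linarith

theorem exists_norm_completedRiemannZeta₀_le_of_strip :
    ∃ K, ∀ s : ℂ, 0 ≤ s.re → s.re ≤ 2 → ‖completedRiemannZeta₀ s‖ ≤ K := by
  have hc : ∀ s : ℂ, MellinConvergent (HurwitzZeta.hurwitzEvenFEPair 0).f_modif s := fun s =>
    ((HurwitzZeta.hurwitzEvenFEPair 0).isStrongFEPair_toStrongFEPair.hasMellin s).1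
  obtain ⟨K, hK⟩ := exists_norm_mellin_le (hc (0 : ℝ)) (hc (1 : ℝ))
  refine ⟨K / 2, fun s h0 h2 => ?_⟩
  have h : completedRiemannZeta₀ s =
      mellin (HurwitzZeta.hurwitzEvenFEPair 0).f_modif (s / 2) / 2 := rfl
  rw [h, norm_div, Complex.norm_ofNat]
  gcongr
  have : (s / 2).re = s.re / 2 := by simp
  exact hK _ (by rw [this]; linarith) (by rw [this]; linarith)

theorem norm_Gamma_le {s : ℂ} (hs : 0 < s.re) : ‖Gamma s‖ ≤ Real.Gamma s.re := by
  rw [Gamma_eq_integral hs, Real.Gamma_eq_integral hs, GammaIntegral]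
  refine norm_integral_le_of_norm_le (Real.GammaIntegral_convergent hs) ?_
  filter_upwards [ae_restrict_mem measurableSet_Ioi] with t (ht : 0 < t)
  rw [norm_mul, norm_cpow_eq_rpow_re_of_pos ht]
  rw [norm_real, Real.norm_of_nonneg (Real.exp_pos _).le, sub_re, one_re]

/-- Γ(x) ≤ n! ≤ exp(n log n) with n = ⌈x⌉. Replacing log n by 2√n costs nothing, since any exponent
below 2 suffices. -/
theorem Real_Gamma_le_exp {x : ℝ} (hx : 1 ≤ x) :
    Real.Gamma x ≤ Real.exp (2 * ((2 * x) * √(2 * x))) := by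
  have h1 : Real.Gamma x ≤ Real.Gamma (x + 1) := by
    rw [Real.Gamma_add_one (by linarith)]
    exact le_mul_of_one_le_left (Real.Gamma_nonneg_of_nonneg (by linarith)) hx
  set n := ⌈x⌉₊
  have hn : x ≤ n := Nat.le_ceil x
  have hn2 : (n : ℝ) ≤ 2 * x := by linarith [Nat.ceil_lt_add_one (by linarith : 0 ≤ x)]
  have h2 : Real.Gamma (x + 1) ≤ Real.Gamma (n + 1) :=
    Real.Gamma_strictMonoOn_Ici.monotoneOn (mem_Ici.2 (by linarith)) (mem_Ici.2 (by linarith))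
      (by linarith)
  rw [Real.Gamma_nat_eq_factorial] at h2
  have h3 : (n.factorial : ℝ) ≤ (n : ℝ) ^ n := by exact_mod_cast n.factorial_le_pow
  have hnpos : (0 : ℝ) < n := by linarith
  have h4 : Real.log n ≤ 2 * √n := by
    have h5 : Real.log √n ≤ √n := Real.log_le_self (Real.sqrt_nonneg _)
    rw [Real.log_sqrt hnpos.le] at h5
    linarith
  have h5 : (n : ℝ) ^ n = Real.exp (n * Real.log n) := by
    rw [mul_comm, Real.exp_mul, Real.exp_log hnpos, Real.rpow_natCast]
  refine (h1.trans h2).trans (h3.trans ?_)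
  rw [h5, Real.exp_le_exp]
  calc (n : ℝ) * Real.log n ≤ n * (2 * √n) := by gcongr
    _ ≤ (2 * x) * (2 * √(2 * x)) := by gcongr
    _ = _ := by ring

/-- For Re s ≤ 2 the Mellin integral gives boundedness. For Re s ≥ 2 the Dirichlet series bounds ζ,
so only the Gamma factor grows. -/
theorem exists_norm_completedRiemannZeta₀_le :
    ∃ K, 1 ≤ K ∧ ∀ s : ℂ, 0 ≤ s.re →
      ‖completedRiemannZeta₀ s‖ ≤ K * Real.exp (2 * (‖s‖ * √‖s‖)) := by
  obtain ⟨K₁, hK₁⟩ := exists_norm_completedRiemannZeta₀_le_of_strip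
  set K₂ : ℝ := ∑' n : ℕ, 1 / ((n : ℝ) ^ (2 : ℕ))
  have hsum : Summable fun n : ℕ => 1 / ((n : ℝ) ^ (2 : ℕ)) :=
    Real.summable_one_div_nat_pow.2 (by norm_num)
  have hK₂ : 0 ≤ K₂ := tsum_nonneg fun n => by positivity
  refine ⟨|K₁| + K₂ + 2, by linarith [abs_nonneg K₁], fun s hs => ?_⟩
  have hexp1 : 1 ≤ Real.exp (2 * (‖s‖ * √‖s‖)) := Real.one_le_exp (by positivity)
  rcases le_total s.re 2 with h2 | h2
  · refine (hK₁ s hs h2).trans ?_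
    have := le_abs_self K₁
    nlinarith [abs_nonneg K₁]
  · have h0 : s ≠ 0 := by rintro rfl; simp at h2; linarith
    have hre : s.re ≤ ‖s‖ := re_le_norm s
    have hz : ‖riemannZeta s‖ ≤ K₂ := by
      rw [zeta_eq_tsum_one_div_nat_cpow (by linarith)]
      refine tsum_of_norm_bounded hsum.hasSum fun n => ?_
      rcases Nat.eq_zero_or_pos n with rfl | hn
      · rw [Nat.cast_zero, zero_cpow h0]; simp
      · rw [norm_div, norm_one, norm_natCast_cpow_of_pos hn]
        have : (1 : ℝ) ≤ n := by exact_mod_cast hn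
        gcongr
        rw [← Real.rpow_natCast]
        exact Real.rpow_le_rpow_of_exponent_le this (by simpa using h2)
    have hG : ‖Gammaℝ s‖ ≤ Real.exp (2 * (‖s‖ * √‖s‖)) := by
      have hs2 : (s / 2).re = s.re / 2 := by simp
      rw [Gammaℝ_def, norm_mul, norm_cpow_eq_rpow_re_of_pos Real.pi_pos]
      have e1 : Real.pi ^ (-s / 2).re ≤ 1 :=
        Real.rpow_le_one_of_one_le_of_nonpos (by linarith [Real.pi_gt_three]) (by
          have : (-s / 2).re = -s.re / 2 := by simp
          rw [this]; linarith)
      have e2 : ‖Gamma (s / 2)‖ ≤ Real.exp (2 * (‖s‖ * √‖s‖)) := by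
        refine (norm_Gamma_le (by rw [hs2]; linarith)).trans
          ((Real_Gamma_le_exp (by rw [hs2]; linarith)).trans ?_)
        rw [Real.exp_le_exp, hs2, mul_div_cancel₀ _ two_ne_zero]
        gcongr
      calc _ ≤ 1 * ‖Gamma (s / 2)‖ := by gcongr
        _ ≤ _ := by rwa [one_mul]
    have hL : completedRiemannZeta s = riemannZeta s * Gammaℝ s := by
      rw [riemannZeta_def_of_ne_zero h0, div_mul_cancel₀ _ (Gammaℝ_ne_zero_of_re_pos (by linarith))]
    have hL0 : completedRiemannZeta₀ s = riemannZeta s * Gammaℝ s + 1 / s + 1 / (1 - s) := by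
      rw [← hL, completedRiemannZeta_eq]; ring
    have e1 : ‖1 / s‖ ≤ 1 := by
      rw [norm_div, norm_one]
      exact div_le_one_of_le₀ (by linarith) (norm_nonneg _)
    have e2 : ‖1 / (1 - s)‖ ≤ 1 := by
      rw [norm_div, norm_one]
      refine div_le_one_of_le₀ ?_ (norm_nonneg _)
      have := abs_re_le_norm (1 - s)
      rw [sub_re, one_re] at this
      linarith [neg_abs_le (1 - s.re)]
    rw [hL0]
    calc _ ≤ ‖riemannZeta s‖ * ‖Gammaℝ s‖ + 1 + 1 :=
          norm_add_le_of_le (norm_add_le_of_le (norm_mul_le _ _) e1) e2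
      _ ≤ K₂ * Real.exp (2 * (‖s‖ * √‖s‖)) + 1 + 1 := by gcongr
      _ ≤ _ := by nlinarith [abs_nonneg K₁]

theorem exists_norm_xi_le :
    ∃ L : ℝ, ∀ R : ℝ, 1 ≤ R → ∀ w : ℂ, ‖w‖ ≤ R →
      ‖xi (1 / 2 + w)‖ ≤ Real.exp (L + 2 * R + 6 * (R * √R)) := by
  obtain ⟨K, hK1, hK⟩ := exists_norm_completedRiemannZeta₀_le
  -- The 7 absorbs the polynomial factor 2R · 3R = 6R² and the summand 1 of `xi`. The remaining R²
  -- is at most exp(2R).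
  refine ⟨Real.log (7 * K), fun R hR w hw => ?_⟩
  have hhalf : ‖(1 / 2 : ℂ)‖ = 1 / 2 := by norm_num
  have key : ∀ s : ℂ, 0 ≤ s.re → ‖s‖ ≤ 2 * R →
      ‖completedRiemannZeta₀ s‖ ≤ K * Real.exp (6 * (R * √R)) := by
    intro s hs hsR
    refine (hK s hs).trans (mul_le_mul_of_nonneg_left (Real.exp_le_exp.2 ?_) (by linarith))
    have h1 : √(2 * R) ≤ 3 / 2 * √R := by
      rw [Real.sqrt_le_left (by positivity), mul_pow, Real.sq_sqrt (by linarith)]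
      linarith
    calc 2 * (‖s‖ * √‖s‖) ≤ 2 * (2 * R * √(2 * R)) := by gcongr
      _ ≤ 2 * (2 * R * (3 / 2 * √R)) := by gcongr
      _ = _ := by ring
  have hL : ‖completedRiemannZeta₀ (1 / 2 + w)‖ ≤ K * Real.exp (6 * (R * √R)) := by
    rcases le_total 0 w.re with h | h
    · refine key _ (by simp; linarith) ((norm_add_le _ _).trans (by rw [hhalf]; linarith))
    · rw [← completedRiemannZeta₀_one_sub]
      have : (1 - (1 / 2 + w)) = 1 / 2 + -w := by ring
      rw [this]
      refine key _ (by simp; linarith) ((norm_add_le _ _).trans (by rw [hhalf, norm_neg]; linarith))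
  have h1 : ‖1 / 2 + w‖ ≤ 2 * R := (norm_add_le _ _).trans (by rw [hhalf]; linarith)
  have h2 : ‖1 / 2 + w - 1‖ ≤ 3 * R := (norm_sub_le _ _).trans (by rw [norm_one]; linarith)
  set E := Real.exp (6 * (R * √R)) with hE
  have hE1 : 1 ≤ E := Real.one_le_exp (by positivity)
  have hR2 : R ^ 2 ≤ Real.exp (2 * R) := by
    have : R ≤ Real.exp R := by linarith [Real.add_one_le_exp R]
    calc R ^ 2 ≤ Real.exp R ^ 2 := by gcongr
      _ = _ := by rw [← Real.exp_nat_mul]; norm_num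
  calc ‖xi (1 / 2 + w)‖ ≤ 2 * R * (3 * R) * (K * E) + 1 := by
        refine norm_add_le_of_le ?_ (by simp)
        rw [norm_mul, norm_mul]
        gcongr
    _ ≤ 7 * K * R ^ 2 * E := by
        have : 1 ≤ K * R ^ 2 * E := by
          have := one_le_mul_of_one_le_of_one_le hK1 (one_le_pow₀ hR : 1 ≤ R ^ 2)
          exact one_le_mul_of_one_le_of_one_le this hE1
        linarith
    _ ≤ 7 * K * Real.exp (2 * R) * E := by gcongr
    _ = _ := by rw [Real.exp_add, Real.exp_add, Real.exp_log (by linarith)]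

theorem tendsto_growth_div_sq (L : ℝ) :
    Tendsto (fun R : ℝ => (L + 2 * R + 6 * (R * √R)) / R ^ 2) atTop (𝓝 0) := by
  have h1 : Tendsto (fun R : ℝ => R⁻¹) atTop (𝓝 0) := tendsto_inv_atTop_zero
  have h2 : Tendsto (fun R : ℝ => (√R)⁻¹) atTop (𝓝 0) :=
    tendsto_inv_atTop_zero.comp Real.tendsto_sqrt_atTop
  have h3 := (((h1.pow 2).const_mul L).add (h1.const_mul 2)).add (h2.const_mul 6)
  norm_num at h3
  refine h3.congr' ?_
  filter_upwards [eventually_gt_atTop 0] with R hR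
  have hs : √R ≠ 0 := (Real.sqrt_pos.2 hR).ne'
  have hsq : √R ^ 2 = R := Real.sq_sqrt hR.le
  field_simp
  linear_combination (-6 * R) * hsq

end Growth

/-! ### Polygamma values at 1 and 1/2 from the Weierstrass product. -/

section Digamma

open Complex Metric

/-- The term `log (1 + z / (j + 1)) - z / (j + 1)` of the logarithm of the Weierstrass product of
the Gamma function. -/
noncomputable def logGammaTerm (j : ℕ) (z : ℂ) : ℂ := log (1 + z / (j + 1)) - z / (j + 1)

theorem norm_div_succ_le (j : ℕ) {z : ℂ} (hz : z ∈ ball (0 : ℂ) (1 / 2)) :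
    ‖z / (j + 1)‖ ≤ 1 / 2 := by
  rw [mem_ball_zero_iff] at hz
  have h1 : ‖((j : ℂ) + 1)‖ = (j : ℝ) + 1 := by exact_mod_cast norm_natCast (j + 1)
  rw [norm_div, h1, div_le_iff₀ (by positivity)]
  have : (0 : ℝ) ≤ j := j.cast_nonneg
  linarith

theorem norm_logGammaTerm_le (j : ℕ) {z : ℂ} (hz : z ∈ ball (0 : ℂ) (1 / 2)) :
    ‖logGammaTerm j z‖ ≤ 1 / ((j : ℝ) + 1) ^ 2 := by
  have h := norm_div_succ_le j hz
  rw [mem_ball_zero_iff] at hz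
  have h1 : ‖((j : ℂ) + 1)‖ = (j : ℝ) + 1 := by exact_mod_cast norm_natCast (j + 1)
  have h2 : (1 - ‖z / (j + 1)‖)⁻¹ ≤ 2 := by
    rw [inv_le_comm₀ (by linarith) (by norm_num)]
    linarith
  calc ‖logGammaTerm j z‖ ≤ ‖z / (j + 1)‖ ^ 2 * (1 - ‖z / (j + 1)‖)⁻¹ / 2 :=
        norm_log_one_add_sub_self_le (by linarith)
    _ ≤ ‖z / (j + 1)‖ ^ 2 * 2 / 2 := by gcongr
    _ = ‖z‖ ^ 2 / ((j : ℝ) + 1) ^ 2 := by rw [norm_div, h1, div_pow]; ring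
    _ ≤ _ := by
      gcongr
      exact pow_le_one₀ (norm_nonneg _) (by linarith)

theorem one_add_div_mem_slitPlane (j : ℕ) {z : ℂ} (hz : z ∈ ball (0 : ℂ) (1 / 2)) :
    1 + z / (j + 1) ∈ slitPlane :=
  mem_slitPlane_of_norm_lt_one (by linarith [norm_div_succ_le j hz])

theorem hasDerivAt_logGammaTerm (j : ℕ) {z : ℂ} (hz : z ∈ ball (0 : ℂ) (1 / 2)) :
    HasDerivAt (logGammaTerm j) ((z - -((j : ℂ) + 1))⁻¹ - ((j : ℂ) + 1)⁻¹) z := by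
  have hj : (j : ℂ) + 1 ≠ 0 := by exact_mod_cast j.succ_ne_zero
  have h := one_add_div_mem_slitPlane j hz
  have h0 := slitPlane_ne_zero h
  have h1 : HasDerivAt (fun z : ℂ => 1 + z / (j + 1)) (1 / ((j : ℂ) + 1)) z :=
    ((hasDerivAt_id z).div_const _).const_add 1
  refine ((h1.clog h).sub ((hasDerivAt_id z).div_const ((j : ℂ) + 1))).congr_deriv ?_
  have h2 : z - -((j : ℂ) + 1) ≠ 0 := by
    have : z - -((j : ℂ) + 1) = ((j : ℂ) + 1) * (1 + z / (j + 1)) := by field_simp; ring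
    rw [this]
    exact mul_ne_zero hj h0
  have h3 : 1 + z / ((j : ℂ) + 1) = (z - -((j : ℂ) + 1)) / (j + 1) := by field_simp; ring
  rw [h3]
  field_simp

theorem summable_one_div_succ_sq : Summable fun j : ℕ => 1 / ((j : ℝ) + 1) ^ 2 := by
  have := (summable_nat_add_iff 1).2 (Real.summable_one_div_nat_pow.2 (by norm_num : 1 < 2))
  simpa using this

theorem prod_add_succ_eq (n : ℕ) {z : ℂ} (hz : z ∈ ball (0 : ℂ) (1 / 2)) :
    ∏ j ∈ Finset.range n, (z + (j + 1 : ℕ)) =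
      n.factorial * exp (∑ j ∈ Finset.range n, logGammaTerm j z + z * (harmonic n : ℂ)) := by
  induction n with
  | zero => simp
  | succ n ih =>
    have hn : (n : ℂ) + 1 ≠ 0 := by exact_mod_cast n.succ_ne_zero
    rw [Finset.prod_range_succ, ih, Finset.sum_range_succ, harmonic_succ, Nat.factorial_succ]
    have h1 : z + (n + 1 : ℕ) = (n + 1) * exp (logGammaTerm n z + z / (n + 1)) := by
      rw [logGammaTerm, sub_add_cancel,
        exp_log (slitPlane_ne_zero (one_add_div_mem_slitPlane n hz))]
      field_simp
      push_cast; ring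
    rw [h1]
    push_cast
    rw [show ∑ j ∈ Finset.range n, logGammaTerm j z + logGammaTerm n z +
      z * ((harmonic n : ℂ) + ((n : ℂ) + 1)⁻¹) = (∑ j ∈ Finset.range n, logGammaTerm j z +
      z * (harmonic n : ℂ)) + (logGammaTerm n z + z / (n + 1)) by ring, exp_add (_ + _)]
    ring

/-- Limit of Euler's product z n! n^z / (z (z+1) ⋯ (z+n)): by `prod_add_succ_eq` it is the
exponential of z (log n - H_n) minus the partial sum of the terms, and H_n - log n → γ. -/
theorem Gamma_one_add_eq_exp {z : ℂ} (hz : z ∈ ball (0 : ℂ) (1 / 2)) :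
    Gamma (1 * z + 1) =
      exp (-(Real.eulerMascheroniConstant * z) - ∑' j, logGammaTerm j z) := by
  by_cases h0 : z = 0
  · simp [h0, logGammaTerm]
  rw [one_mul, Gamma_add_one z h0]
  have h1 : Tendsto (fun n => z * GammaSeq z n) atTop (𝓝 (z * Gamma z)) :=
    (GammaSeq_tendsto_Gamma z).const_mul z
  have hs : Summable fun j => logGammaTerm j z :=
    Summable.of_norm_bounded summable_one_div_succ_sq fun j => norm_logGammaTerm_le j hz
  have h2 : Tendsto (fun n : ℕ => (((harmonic n : ℝ) - Real.log n : ℝ) : ℂ)) atTop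
      (𝓝 (Real.eulerMascheroniConstant : ℂ)) :=
    (continuous_ofReal.tendsto _).comp Real.tendsto_harmonic_sub_log
  refine tendsto_nhds_unique h1 (((continuous_exp.tendsto _).comp
    ((h2.mul_const z).neg.sub hs.hasSum.tendsto_sum_nat)).congr' ?_)
  filter_upwards [eventually_ne_atTop 0] with n hn
  have hn' : (n : ℂ) ≠ 0 := Nat.cast_ne_zero.2 hn
  have hf : (n.factorial : ℂ) ≠ 0 := Nat.cast_ne_zero.2 n.factorial_ne_zero
  rw [Function.comp_apply, GammaSeq, Finset.prod_range_succ', prod_add_succ_eq n hz,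
    Nat.cast_zero, add_zero, cpow_def_of_ne_zero hn',
    show log (n : ℂ) = (Real.log n : ℂ) by rw [ofReal_log n.cast_nonneg, ofReal_natCast]]
  have : z * (exp ((Real.log n : ℂ) * z) * n.factorial / (n.factorial *
      exp (∑ j ∈ Finset.range n, logGammaTerm j z + z * (harmonic n : ℂ)) * z)) =
      exp ((Real.log n : ℂ) * z) /
        exp (∑ j ∈ Finset.range n, logGammaTerm j z + z * (harmonic n : ℂ)) := by
    field_simp
  rw [this, ← exp_sub]
  congr 1
  push_cast
  ring

theorem tendsto_sum_inv_succ_pow {k : ℕ} (hk : 1 ≤ k) :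
    Tendsto (fun n => ∑ j ∈ Finset.range n, (((j : ℂ) + 1) ^ (k + 1))⁻¹) atTop
      (𝓝 (riemannZeta ((k + 1 : ℕ) : ℂ))) := by
  have hs : Summable fun j : ℕ => (((j : ℂ) + 1) ^ (k + 1))⁻¹ := by
    have h := (summable_nat_add_iff 1).2
      (Real.summable_one_div_nat_pow.2 (by omega : 1 < k + 1))
    refine Summable.of_norm_bounded h fun j => le_of_eq ?_
    rw [norm_inv, norm_pow, one_div]
    congr 2
    exact_mod_cast norm_natCast (j + 1)
  have h1 : riemannZeta ((k + 1 : ℕ) : ℂ) = ∑' j : ℕ, (((j : ℂ) + 1) ^ (k + 1))⁻¹ := by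
    rw [zeta_eq_tsum_one_div_nat_add_one_cpow (by
      rw [natCast_re]; exact_mod_cast (by omega : 1 < k + 1))]
    refine tsum_congr fun j => ?_
    rw [cpow_natCast, one_div]
  rw [h1]
  exact hs.hasSum.tendsto_sum_nat

/-- Termwise differentiation. The constants 1/(j+1) in the first derivatives disappear because k ≥
1. -/
theorem iteratedDeriv_succ_tsum_logGammaTerm {k : ℕ} (hk : 1 ≤ k) :
    iteratedDeriv (k + 1) (fun z => ∑' j, logGammaTerm j z) 0 =
      (-1) ^ k * k.factorial * riemannZeta ((k + 1 : ℕ) : ℂ) := by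
  have h0 : (0 : ℂ) ∈ ball (0 : ℂ) (1 / 2) := mem_ball_self (by norm_num)
  have hd : ∀ j, DifferentiableOn ℂ (logGammaTerm j) (ball 0 (1 / 2)) := fun j z hz =>
    (hasDerivAt_logGammaTerm j hz).differentiableAt.differentiableWithinAt
  have hlim := tendsto_iteratedDeriv_of_tendstoLocallyUniformlyOn isOpen_ball
    (tendstoUniformlyOn_tsum_nat summable_one_div_succ_sq
      fun j z hz => norm_logGammaTerm_le j hz).tendstoLocallyUniformlyOn
    (fun n => DifferentiableOn.fun_sum fun j _ => hd j) (k + 1) h0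
  refine tendsto_nhds_unique hlim
    (((tendsto_sum_inv_succ_pow hk).const_mul ((-1) ^ k * (k.factorial : ℂ))).congr fun n => ?_)
  rw [iteratedDeriv_fun_sum fun j _ =>
    ((hd j).analyticAt (isOpen_ball.mem_nhds h0)).contDiffAt, Finset.mul_sum]
  refine Finset.sum_congr rfl fun j _ => ?_
  have hj : (0 : ℂ) - -((j : ℂ) + 1) ≠ 0 := by
    rw [zero_sub, neg_neg]; exact_mod_cast j.succ_ne_zero
  have h1 : deriv (logGammaTerm j) =ᶠ[𝓝 0]
      (fun z => (z - -((j : ℂ) + 1))⁻¹) - fun _ => ((j : ℂ) + 1)⁻¹ := by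
    filter_upwards [isOpen_ball.mem_nhds h0] with z hz
    exact (hasDerivAt_logGammaTerm j hz).deriv
  rw [iteratedDeriv_succ', h1.iteratedDeriv_eq, iteratedDeriv_sub
    ((by fun_prop : AnalyticAt ℂ (fun z : ℂ => z - -((j : ℂ) + 1)) 0).fun_inv hj).contDiffAt
    contDiffAt_const, iteratedDeriv_sub_inv, iteratedDeriv_const, if_neg (by omega), sub_zero,
    zero_sub, neg_neg]

theorem analyticAt_Gamma_of_re_pos {s : ℂ} (hs : 0 < s.re) : AnalyticAt ℂ Gamma s := by
  refine DifferentiableOn.analyticAt (s := {s | 0 < s.re}) (fun z (hz : 0 < z.re) => ?_)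
    ((isOpen_lt continuous_const continuous_re).mem_nhds hs)
  refine (differentiableAt_Gamma z fun m h => ?_).differentiableWithinAt
  rw [h] at hz
  simp at hz
  linarith [(m.cast_nonneg : (0 : ℝ) ≤ m)]

theorem iteratedDeriv_logDeriv_Gamma_one {k : ℕ} (hk : 1 ≤ k) :
    iteratedDeriv k (logDeriv Gamma) 1 =
      (-1) ^ (k + 1) * k.factorial * riemannZeta ((k + 1 : ℕ) : ℂ) := by
  have h0 : (0 : ℂ) ∈ ball (0 : ℂ) (1 / 2) := mem_ball_self (by norm_num)
  have hΓ : AnalyticAt ℂ Gamma 1 := analyticAt_Gamma_of_re_pos (by simp)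
  have hS : DifferentiableOn ℂ (fun z => ∑' j, logGammaTerm j z) (ball 0 (1 / 2)) :=
    differentiableOn_tsum_of_summable_norm summable_one_div_succ_sq
      (fun j z hz => (hasDerivAt_logGammaTerm j hz).differentiableAt.differentiableWithinAt)
      isOpen_ball fun j z hz => norm_logGammaTerm_le j hz
  have h1 : (logDeriv fun w => Gamma (1 * w + 1)) =ᶠ[𝓝 0]
      (fun _ => -(Real.eulerMascheroniConstant : ℂ)) - deriv fun z => ∑' j, logGammaTerm j z := by
    filter_upwards [isOpen_ball.mem_nhds h0] with z hz
    have e1 : (fun w => Gamma (1 * w + 1)) =ᶠ[𝓝 z] fun z =>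
        exp (-(Real.eulerMascheroniConstant * z) - ∑' j, logGammaTerm j z) := by
      filter_upwards [isOpen_ball.mem_nhds hz] with w hw using Gamma_one_add_eq_exp hw
    rw [(logDeriv_congr_nhds e1).self_of_nhds, logDeriv_apply]
    have e2 := (((hasDerivAt_id z).const_mul (Real.eulerMascheroniConstant : ℂ)).neg.sub
      (hS.differentiableAt (isOpen_ball.mem_nhds hz)).hasDerivAt).cexp
    simp only [mul_one] at e2
    erw [e2.deriv]
    exact mul_div_cancel_left₀ _ (exp_ne_zero _)
  have h2 := iteratedDeriv_logDeriv_comp_affine (f := Gamma) (a := 1) (b := 1) (z := 0) k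
    (by simpa using hΓ) (by simp)
  rw [one_pow, one_mul, mul_zero, zero_add] at h2
  have hSa : AnalyticAt ℂ (fun z => ∑' j, logGammaTerm j z) 0 :=
    hS.analyticAt (isOpen_ball.mem_nhds h0)
  rw [← h2, h1.iteratedDeriv_eq, iteratedDeriv_sub contDiffAt_const hSa.deriv.contDiffAt,
    iteratedDeriv_const, if_neg (by omega), ← iteratedDeriv_succ',
    iteratedDeriv_succ_tsum_logGammaTerm hk]
  ring

theorem iteratedDeriv_logDeriv_cpow {k : ℕ} (hk : 1 ≤ k) {c b : ℂ} (hc : c ≠ 0) (hb : b ≠ 0)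
    (α β z : ℂ) :
    iteratedDeriv k (logDeriv fun s => b * c ^ (α * s + β)) z = 0 := by
  have h : (logDeriv fun s : ℂ => b * c ^ (α * s + β)) = fun _ => log c * α := by
    ext s
    have h1 : HasDerivAt (fun s : ℂ => α * s + β) α s := by
      simpa using ((hasDerivAt_id s).const_mul α).add_const β
    have h2 := h1.const_cpow (c := c) (Or.inl hc)
    rw [logDeriv_const_mul s b hb, logDeriv_apply, h2.deriv]
    have : c ^ (α * s + β) ≠ 0 := by simp [cpow_eq_zero_iff, hc]
    field_simp
  rw [h, iteratedDeriv_const, if_neg (by omega)]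

/-- Differentiating the duplication formula Γ(s) Γ(s + 1/2) = Γ(2s) 2^{1-2s} √π logarithmically at s
= 1/2 gives ψ^{(k)}(1/2) + ψ^{(k)}(1) = 2^{k+1} ψ^{(k)}(1). The exponential factor contributes only
for k = 0. -/
theorem iteratedDeriv_logDeriv_Gamma_one_half {k : ℕ} (hk : 1 ≤ k) :
    iteratedDeriv k (logDeriv Gamma) (1 / 2) =
      (2 ^ (k + 1) - 1) * ((-1) ^ (k + 1) * k.factorial * riemannZeta ((k + 1 : ℕ) : ℂ)) := by
  have hhalf : (1 : ℂ) * (1 / 2) + 1 / 2 = 1 := by norm_num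
  have htwo : (2 : ℂ) * (1 / 2) + 0 = 1 := by norm_num
  have h1 : AnalyticAt ℂ Gamma 1 := analyticAt_Gamma_of_re_pos (by simp)
  have h2 : AnalyticAt ℂ Gamma (1 / 2) := analyticAt_Gamma_of_re_pos (by norm_num)
  have h1' : AnalyticAt ℂ Gamma (1 * (1 / 2) + 1 / 2) := by rw [hhalf]; exact h1
  have h1'' : AnalyticAt ℂ Gamma (2 * (1 / 2) + 0) := by rw [htwo]; exact h1
  have h3 : AnalyticAt ℂ (fun s : ℂ => Gamma (1 * s + 1 / 2)) (1 / 2) :=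
    AnalyticAt.fun_comp (f := fun s : ℂ => 1 * s + 1 / 2) h1' (by fun_prop)
  have h4 : AnalyticAt ℂ (fun s : ℂ => Gamma (2 * s + 0)) (1 / 2) :=
    AnalyticAt.fun_comp (f := fun s : ℂ => 2 * s + 0) h1'' (by fun_prop)
  have hpi : (√Real.pi : ℂ) ≠ 0 := ofReal_ne_zero.2 (Real.sqrt_pos.2 Real.pi_pos).ne'
  have h5 : AnalyticAt ℂ (fun s : ℂ => (√Real.pi : ℂ) * 2 ^ (-2 * s + 1)) (1 / 2) :=
    analyticAt_const.mul (Differentiable.analyticAt (fun s => by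
      exact DifferentiableAt.const_cpow (by fun_prop) (Or.inl two_ne_zero)) _)
  have hfun : (fun s => Gamma s * Gamma (1 * s + 1 / 2)) =
      fun s => Gamma (2 * s + 0) * ((√Real.pi : ℂ) * 2 ^ (-2 * s + 1)) := by
    ext s
    rw [one_mul, add_zero, Gamma_mul_Gamma_add_half]
    rw [show -2 * s + 1 = 1 - 2 * s by ring]
    ring
  have e1 := iteratedDeriv_logDeriv_mul h2 h3 (Gamma_ne_zero_of_re_pos (by norm_num))
    (by rw [hhalf]; simp) k
  have e2 := iteratedDeriv_logDeriv_mul h4 h5 (by rw [htwo]; simp)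
    (mul_ne_zero hpi (by simp)) k
  rw [hfun, e2, iteratedDeriv_logDeriv_cpow hk two_ne_zero hpi,
    iteratedDeriv_logDeriv_comp_affine k h1'' (by rw [htwo]; simp),
    iteratedDeriv_logDeriv_comp_affine k h1' (by rw [hhalf]; simp), htwo, hhalf,
    iteratedDeriv_logDeriv_Gamma_one hk] at e1
  linear_combination -e1

end Digamma

/-! ### Stieltjes constants as Taylor coefficients of ζ(s) - 1/(s-1) at 1; no zeros of ζ on (0,1).
-/

section StieltjesExpansion

open Complex Set

/-- The entire function `(exp z - 1) / z`. -/
noncomputable def expSlope : ℂ → ℂ := dslope exp 0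

theorem mul_expSlope (z : ℂ) : z * expSlope z = exp z - 1 := by
  have := sub_smul_dslope exp 0 z
  simpa [expSlope] using this

theorem differentiable_expSlope : Differentiable ℂ expSlope := by
  rw [← differentiableOn_univ, expSlope, Complex.differentiableOn_dslope univ_mem]
  exact differentiable_exp.differentiableOn

/-- Leibniz applied to z · `expSlope` z = e^z - 1, differentiated k + 1 times at 0: only the term
with one derivative on z survives. -/
theorem iteratedDeriv_expSlope_zero (k : ℕ) : iteratedDeriv k expSlope 0 = ((k : ℂ) + 1)⁻¹ := by
  have h1 : id * expSlope = fun z => exp z - 1 := funext mul_expSlope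
  have h2 : iteratedDeriv (k + 1) (fun z => exp z - 1) 0 = 1 := by
    have h3 : deriv (fun z => exp z - 1) = fun z => exp (1 * z) := by ext z; simp
    rw [iteratedDeriv_succ', h3, iteratedDeriv_cexp_const_mul]
    simp
  rw [← h1, iteratedDeriv_mul contDiffAt_id (differentiable_expSlope.analyticAt 0).contDiffAt,
    Finset.sum_eq_single_of_mem 1 (by simp) (fun i _ hi => by
      rw [iteratedDeriv_id]
      by_cases h0 : i = 0 <;> simp [h0, hi])] at h2
  simp only [Nat.choose_one_right, Nat.cast_add, Nat.cast_one, iteratedDeriv_one, deriv_id,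
    mul_one, Nat.add_sub_cancel] at h2
  exact eq_inv_of_mul_eq_one_right h2

/-- `∫_1^x t^(-s) dt`, in a form that makes sense for `s = 1`. -/
noncomputable def powIntegral (s : ℂ) (x : ℝ) : ℂ :=
  Real.log x * expSlope ((1 - s) * Real.log x)

theorem hasDerivAt_powIntegral (s : ℂ) {x : ℝ} (hx : 0 < x) :
    HasDerivAt (powIntegral s) (exp (-s * Real.log x)) x := by
  have hx' : (x : ℂ) ≠ 0 := ofReal_ne_zero.2 hx.ne'
  have hl : HasDerivAt (fun y : ℝ => (Real.log y : ℂ)) ((x⁻¹ : ℝ) : ℂ) x :=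
    (Real.hasDerivAt_log hx.ne').ofReal_comp
  have hq : HasDerivAt (fun z => z * expSlope z) (exp ((1 - s) * Real.log x))
      ((1 - s) * Real.log x) := by
    rw [show (fun z => z * expSlope z) = fun z => exp z - 1 from funext mul_expSlope]
    exact (hasDerivAt_exp _).sub_const 1
  have hq2 := ((hasDerivAt_id ((1 - s) * (Real.log x : ℂ))).mul
    (differentiable_expSlope ((1 - s) * Real.log x)).hasDerivAt).unique hq
  have hc := (differentiable_expSlope ((1 - s) * Real.log x)).hasDerivAt.comp x
    (hl.const_mul (1 - s))
  refine (hl.mul hc).congr_deriv ?_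
  have he : exp ((1 - s) * Real.log x) = exp (-s * Real.log x) * x := by
    rw [show (1 - s) * (Real.log x : ℂ) = -s * Real.log x + Real.log x by ring, exp_add,
      ← ofReal_exp (Real.log x), Real.exp_log hx]
  simp only [id, one_mul] at hq2
  rw [he] at hq2
  push_cast
  simp only [Function.comp_apply, neg_mul] at hq2 ⊢
  field_simp
  linear_combination hq2

/-- `∑_{m ≤ N} m^(-s) - ∫_1^N t^(-s) dt`. -/
noncomputable def zetaPartial (N : ℕ) (s : ℂ) : ℂ :=
  ∑ m ∈ Finset.Icc 1 N, exp (-s * Real.log m) - powIntegral s N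

/-- `(N + 1)^(-s) x - ∫_1^x t^(-s) dt`. -/
noncomputable def zetaGap (N : ℕ) (s : ℂ) (x : ℝ) : ℂ :=
  x * exp (-s * Real.log (N + 1 : ℕ)) - powIntegral s x

/-- The increment (N+1)^{-s} - ∫_N^{N+1} t^{-s} dt is written as a difference of values of one
function of x, so that it can be estimated by the mean value inequality. -/
theorem zetaPartial_succ (N : ℕ) (s : ℂ) :
    zetaPartial (N + 1) s = zetaPartial N s + (zetaGap N s (N + 1 : ℕ) - zetaGap N s N) := by
  rw [zetaPartial, zetaPartial, zetaGap, zetaGap, Finset.sum_Icc_succ_top (by omega)]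
  push_cast
  ring

theorem hasDerivAt_zetaGap (N : ℕ) (s : ℂ) {x : ℝ} (hx : 0 < x) :
    HasDerivAt (zetaGap N s)
      (exp (-s * Real.log (N + 1 : ℕ)) - exp (-s * Real.log x)) x := by
  have h := ((hasDerivAt_id x).ofReal_comp.mul_const (exp (-s * Real.log (N + 1 : ℕ)))).sub
    (hasDerivAt_powIntegral s hx)
  exact h.congr_deriv (by simp)

theorem norm_exp_neg_mul_log_sub_le {N : ℕ} (hN : 1 ≤ N) {s : ℂ} (hs : 0 ≤ s.re) {x : ℝ}
    (hx : x ∈ Icc (N : ℝ) (N + 1 : ℕ)) :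
    ‖exp (-s * Real.log (N + 1 : ℕ)) - exp (-s * Real.log x)‖ ≤
      ‖s‖ * Real.exp (-s.re * Real.log N) / N := by
  have hN0 : (0 : ℝ) < N := by exact_mod_cast hN
  have hd : ∀ y ∈ Icc (N : ℝ) (N + 1 : ℕ),
      HasDerivWithinAt (fun y : ℝ => exp (-s * Real.log y))
        (exp (-s * Real.log y) * (-s * ((y⁻¹ : ℝ) : ℂ))) (Icc (N : ℝ) (N + 1 : ℕ)) y := by
    intro y hy
    have hy0 : 0 < y := hN0.trans_le hy.1
    exact (((Real.hasDerivAt_log hy0.ne').ofReal_comp.const_mul (-s)).cexp).hasDerivWithinAt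
  have hb : ∀ y ∈ Icc (N : ℝ) (N + 1 : ℕ),
      ‖exp (-s * Real.log y) * (-s * ((y⁻¹ : ℝ) : ℂ))‖ ≤
        ‖s‖ * Real.exp (-s.re * Real.log N) / N := by
    intro y hy
    have hy0 : 0 < y := hN0.trans_le hy.1
    have h1 : (-s * (Real.log y : ℂ)).re = -s.re * Real.log y := by
      rw [re_mul_ofReal, neg_re]
    rw [norm_mul, norm_exp, norm_mul, norm_neg, norm_real, norm_inv, Real.norm_of_nonneg hy0.le, h1,
      mul_left_comm, mul_div_assoc, div_eq_mul_inv]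
    have e1 : Real.exp (-s.re * Real.log y) ≤ Real.exp (-s.re * Real.log N) := by
      have := Real.log_le_log hN0 hy.1
      rw [Real.exp_le_exp]
      nlinarith
    have e2 : y⁻¹ ≤ (N : ℝ)⁻¹ := inv_anti₀ hN0 hy.1
    gcongr
  have h := (convex_Icc (N : ℝ) (N + 1 : ℕ)).norm_image_sub_le_of_norm_hasDerivWithin_le hd hb hx
    (right_mem_Icc.2 (by push_cast; linarith))
  refine h.trans (mul_le_of_le_one_right (by positivity) ?_)
  rw [Real.norm_eq_abs, abs_of_nonneg (sub_nonneg.2 hx.2)]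
  push_cast
  linarith [hx.1]

theorem norm_zetaGap_sub_le {N : ℕ} (hN : 1 ≤ N) {s : ℂ} (hs : 0 ≤ s.re) :
    ‖zetaGap N s (N + 1 : ℕ) - zetaGap N s N‖ ≤ ‖s‖ * Real.exp (-s.re * Real.log N) / N := by
  have hN0 : (0 : ℝ) < N := by exact_mod_cast hN
  have hle : (N : ℝ) ≤ (N + 1 : ℕ) := by push_cast; linarith
  have h := (convex_Icc (N : ℝ) (N + 1 : ℕ)).norm_image_sub_le_of_norm_hasDerivWithin_le
    (fun y hy => (hasDerivAt_zetaGap N s (hN0.trans_le hy.1)).hasDerivWithinAt)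
    (fun y hy => norm_exp_neg_mul_log_sub_le hN hs hy) (left_mem_Icc.2 hle) (right_mem_Icc.2 hle)
  simpa using h

theorem zetaGap_sub_re_nonpos {N : ℕ} (hN : 1 ≤ N) {σ : ℝ} (hσ : 0 ≤ σ) :
    (zetaGap N σ (N + 1 : ℕ) - zetaGap N σ N).re ≤ 0 := by
  have hN0 : (0 : ℝ) < N := by exact_mod_cast hN
  have hle : (N : ℝ) ≤ (N + 1 : ℕ) := by push_cast; linarith
  have hd : ∀ x : ℝ, 0 < x → HasDerivAt (fun x => (zetaGap N σ x).re)
      (Real.exp (-σ * Real.log (N + 1 : ℕ)) - Real.exp (-σ * Real.log x)) x := by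
    intro x hx
    have := reCLM.hasFDerivAt.comp_hasDerivAt x (hasDerivAt_zetaGap N σ hx)
    refine this.congr_deriv ?_
    rw [reCLM_apply, sub_re]
    norm_cast
  have hanti : AntitoneOn (fun x => (zetaGap N σ x).re) (Icc (N : ℝ) (N + 1 : ℕ)) := by
    refine antitoneOn_of_deriv_nonpos (convex_Icc _ _)
      (fun x hx => (hd x (hN0.trans_le hx.1)).continuousAt.continuousWithinAt)
      (fun x hx => ?_) (fun x hx => ?_)
    · rw [interior_Icc] at hx
      exact (hd x (hN0.trans hx.1)).differentiableAt.differentiableWithinAt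
    · rw [interior_Icc] at hx
      rw [(hd x (hN0.trans hx.1)).deriv, sub_nonpos, Real.exp_le_exp]
      have := Real.log_le_log (hN0.trans hx.1) hx.2.le
      nlinarith
  have := hanti (left_mem_Icc.2 hle) (right_mem_Icc.2 hle) hle
  rw [sub_re]
  simp only at this
  linarith

theorem differentiable_zetaPartial (N : ℕ) : Differentiable ℂ (zetaPartial N) := by
  unfold zetaPartial powIntegral
  have := differentiable_expSlope
  fun_prop

theorem zetaPartial_one (s : ℂ) : zetaPartial 1 s = 1 := by
  simp [zetaPartial, powIntegral]

theorem zetaPartial_succ_eq_sum (n : ℕ) (s : ℂ) :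
    zetaPartial (n + 1) s = 1 + ∑ j ∈ Finset.range n,
      (zetaGap (j + 1) s (j + 1 + 1 : ℕ) - zetaGap (j + 1) s (j + 1 : ℕ)) := by
  induction n with
  | zero => simp [zetaPartial_one]
  | succ n ih => rw [zetaPartial_succ, ih, Finset.sum_range_succ, add_assoc]

/-- The increments are at most |s| N^{-Re s - 1}, so the Weierstrass test applies on bounded sets
where Re s stays above Re s₀ / 2. -/
theorem tendstoLocallyUniformlyOn_zetaPartial :
    ∃ F : ℂ → ℂ,
      TendstoLocallyUniformlyOn (fun n => zetaPartial (n + 1)) F atTop {s | 0 < s.re} := by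
  refine ⟨fun s => 1 + ∑' j : ℕ,
    (zetaGap (j + 1) s (j + 1 + 1 : ℕ) - zetaGap (j + 1) s (j + 1 : ℕ)), ?_⟩
  refine tendstoLocallyUniformlyOn_of_forall_exists_nhds fun s₀ (hs₀ : 0 < s₀.re) => ?_
  refine ⟨{s | s₀.re / 2 < s.re ∧ ‖s‖ < ‖s₀‖ + 1}, mem_nhdsWithin_of_mem_nhds
    (((isOpen_lt continuous_const continuous_re).inter
      (isOpen_lt continuous_norm continuous_const)).mem_nhds ⟨?_, ?_⟩), ?_⟩
  · show s₀.re / 2 < s₀.re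
    linarith
  · show ‖s₀‖ < ‖s₀‖ + 1
    linarith
  have hu : Summable fun j : ℕ => (‖s₀‖ + 1) * (1 / ((j + 1 : ℕ) : ℝ) ^ (s₀.re / 2 + 1)) :=
    ((summable_nat_add_iff 1).2
      (Real.summable_one_div_nat_rpow.2 (by linarith : 1 < s₀.re / 2 + 1))).mul_left _
  have h := tendstoUniformlyOn_tsum_nat hu (s := {s : ℂ | s₀.re / 2 < s.re ∧ ‖s‖ < ‖s₀‖ + 1})
    (f := fun j s => zetaGap (j + 1) s (j + 1 + 1 : ℕ) - zetaGap (j + 1) s (j + 1 : ℕ)) ?_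
  · have h2 := (tendsto_const_nhds (x := (1 : ℂ)).tendstoUniformlyOn_const
      {s : ℂ | s₀.re / 2 < s.re ∧ ‖s‖ < ‖s₀‖ + 1}).add h
    refine h2.congr (Eventually.of_forall fun n s _ => ?_)
    simp [zetaPartial_succ_eq_sum]
  · rintro j s ⟨hs1, hs2⟩
    refine (norm_zetaGap_sub_le (by omega) (by linarith)).trans ?_
    have hj : (0 : ℝ) < (j + 1 : ℕ) := by positivity
    have hj1 : (1 : ℝ) ≤ (j + 1 : ℕ) := by push_cast; linarith [(j.cast_nonneg : (0 : ℝ) ≤ j)]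
    have hl := Real.log_nonneg hj1
    rw [Real.rpow_add_one hj.ne', Real.rpow_def_of_pos hj, mul_div_assoc]
    have e1 : Real.exp (-s.re * Real.log (j + 1 : ℕ)) / (j + 1 : ℕ) ≤
        1 / (Real.exp (Real.log (j + 1 : ℕ) * (s₀.re / 2)) * (j + 1 : ℕ)) := by
      rw [← div_div, one_div, ← Real.exp_neg]
      gcongr
      nlinarith
    gcongr

theorem sum_Icc_one_eq_sum_range {M : Type*} [AddCommMonoid M] (f : ℕ → M) (n : ℕ) :
    ∑ m ∈ Finset.Icc 1 n, f m = ∑ j ∈ Finset.range n, f (j + 1) := by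
  induction n with
  | zero => simp
  | succ n ih => rw [Finset.sum_Icc_succ_top (by omega), ih, Finset.sum_range_succ]

theorem tendsto_sum_exp_neg_mul_log {s : ℂ} (hs : 1 < s.re) :
    Tendsto (fun n : ℕ => ∑ m ∈ Finset.Icc 1 n, exp (-s * Real.log m)) atTop
      (𝓝 (riemannZeta s)) := by
  have hsum : Summable fun n : ℕ => 1 / ((n + 1 : ℕ) : ℂ) ^ s :=
    (summable_nat_add_iff (f := fun n : ℕ => 1 / (n : ℂ) ^ s) 1).2
      (Complex.summable_one_div_nat_cpow.2 hs)
  have h := hsum.hasSum.tendsto_sum_nat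
  have hz := zeta_eq_tsum_one_div_nat_add_one_cpow hs
  norm_cast at hz
  rw [hz]
  refine h.congr fun n => ?_
  rw [sum_Icc_one_eq_sum_range]
  refine Finset.sum_congr rfl fun j _ => ?_
  have hj : ((j + 1 : ℕ) : ℂ) ≠ 0 := Nat.cast_ne_zero.2 j.succ_ne_zero
  rw [cpow_def_of_ne_zero hj, one_div, ← exp_neg, ← natCast_log]
  congr 1
  ring

theorem tendsto_zetaPartial {s : ℂ} (hs : 1 < s.re) :
    Tendsto (fun n => zetaPartial n s) atTop (𝓝 (riemannZeta₀ s)) := by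
  have h1 : s ≠ 1 := by rintro rfl; simp at hs
  have h1' : 1 - s ≠ 0 := sub_ne_zero.2 h1.symm
  have h1'' : s - 1 ≠ 0 := sub_ne_zero.2 h1
  have hE : Tendsto (fun n : ℕ => exp ((1 - s) * Real.log n)) atTop (𝓝 0) := by
    rw [tendsto_zero_iff_norm_tendsto_zero]
    have h2 : Tendsto (fun n : ℕ => (s.re - 1) * Real.log n) atTop atTop :=
      (Real.tendsto_log_atTop.comp tendsto_natCast_atTop_atTop).const_mul_atTop (by linarith)
    refine (Real.tendsto_exp_neg_atTop_nhds_zero.comp h2).congr fun n => ?_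
    rw [norm_exp, re_mul_ofReal, sub_re, one_re, Function.comp_apply]
    ring_nf
  have h3 := (tendsto_sum_exp_neg_mul_log hs).sub ((hE.sub_const 1).div_const (1 - s))
  have h4 : riemannZeta₀ s = riemannZeta s - (0 - 1) / (1 - s) := by
    rw [riemannZeta_eq_inv_sub_add h1]
    field_simp
    ring
  rw [h4]
  refine h3.congr fun n => ?_
  rw [zetaPartial, powIntegral]
  congr 1
  rw [div_eq_iff h1', ← mul_expSlope]
  ring

/-- For Re s > 1 the limit is ζ(s) - 1/(s-1); the identity theorem extends this to the half-plane Re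
s > 0. -/
theorem tendstoLocallyUniformlyOn_zetaPartial_riemannZeta₀ :
    TendstoLocallyUniformlyOn (fun n => zetaPartial (n + 1)) riemannZeta₀ atTop
      {s | 0 < s.re} := by
  obtain ⟨F, hF⟩ := tendstoLocallyUniformlyOn_zetaPartial
  have hU : IsOpen {s : ℂ | 0 < s.re} := isOpen_lt continuous_const continuous_re
  have hFd : DifferentiableOn ℂ F {s : ℂ | 0 < s.re} := hF.differentiableOn
    (Eventually.of_forall fun n => (differentiable_zetaPartial _).differentiableOn) hU
  refine hF.congr_right ?_
  refine (hFd.analyticOnNhd hU).eqOn_of_preconnected_of_eventuallyEq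
    (differentiable_riemannZeta₀.differentiableOn.analyticOnNhd hU)
    (convex_halfSpace_re_gt 0).isPreconnected (z₀ := 2) (by simp) ?_
  filter_upwards [(isOpen_lt continuous_const continuous_re).mem_nhds
    (show (2 : ℂ) ∈ {s : ℂ | 1 < s.re} by simp)] with s (hs : 1 < s.re)
  exact tendsto_nhds_unique (hF.tendsto_at (show 0 < s.re by linarith))
    ((tendsto_add_atTop_iff_nat 1).2 (tendsto_zetaPartial hs))

/-- As t^{-σ} decreases, the partial sums decrease from 1, so ζ(σ) - 1/(σ-1) ≤ 1. Since 1/(σ-1) <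
-1, ζ(σ) < 0. This ensures that every nontrivial zero is some 1/2 ± iτ with Re τ > 0. -/
theorem riemannZeta_ne_zero_of_mem_Ioo {σ : ℝ} (hσ : σ ∈ Ioo (0 : ℝ) 1) :
    riemannZeta σ ≠ 0 := by
  have h1 : ∀ n, (zetaPartial (n + 1) σ).re ≤ 1 := by
    intro n
    induction n with
    | zero => simp [zetaPartial_one]
    | succ n ih =>
      rw [zetaPartial_succ, add_re]
      have := zetaGap_sub_re_nonpos (N := n + 1) (by omega) hσ.1.le
      linarith
  have h2 : (riemannZeta₀ σ).re ≤ 1 :=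
    le_of_tendsto ((continuous_re.tendsto _).comp
      (tendstoLocallyUniformlyOn_zetaPartial_riemannZeta₀.tendsto_at
        (show 0 < (σ : ℂ).re by simpa using hσ.1))) (Eventually.of_forall h1)
  have hne : (σ : ℂ) ≠ 1 := by exact_mod_cast hσ.2.ne
  intro h
  rw [riemannZeta_eq_inv_sub_add hne] at h
  have h3 := congrArg re h
  have h4 : ((σ : ℂ) - 1)⁻¹ = ((σ - 1)⁻¹ : ℝ) := by push_cast; rfl
  rw [h4, add_re, ofReal_re, zero_re] at h3
  have h5 : (σ - 1)⁻¹ < -1 := by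
    have : 1 < (1 - σ)⁻¹ := (one_lt_inv₀ (by linarith [hσ.2])).2 (by linarith [hσ.1])
    have h6 : (σ - 1)⁻¹ = -(1 - σ)⁻¹ := by rw [← inv_neg]; ring_nf
    linarith
  linarith

theorem iteratedDeriv_zetaPartial_one (k N : ℕ) :
    iteratedDeriv k (zetaPartial N) 1 = (-1) ^ k * (stieltjesSeq k N : ℂ) := by
  have hq : AnalyticAt ℂ expSlope (-(Real.log N : ℂ) * 1 + Real.log N) :=
    differentiable_expSlope.analyticAt _
  have hfun : zetaPartial N = (fun s => ∑ m ∈ Finset.Icc 1 N, exp (-(Real.log m : ℂ) * s)) -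
      fun s => (Real.log N : ℂ) * expSlope (-(Real.log N : ℂ) * s + Real.log N) := by
    ext s
    simp only [zetaPartial, powIntegral, Pi.sub_apply]
    congr 1
    · refine Finset.sum_congr rfl fun m _ => ?_
      congr 1; ring
    · congr 2; ring
  have he : ∀ c : ℂ, AnalyticAt ℂ (fun s => exp (c * s)) 1 := fun c => by fun_prop
  rw [hfun, iteratedDeriv_sub (ContDiffAt.sum fun m _ => (he _).contDiffAt)
    (analyticAt_const.fun_mul (AnalyticAt.fun_comp
      (f := fun s : ℂ => -(Real.log N : ℂ) * s + Real.log N) hq (by fun_prop))).contDiffAt,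
    iteratedDeriv_fun_sum fun m _ => (he _).contDiffAt, iteratedDeriv_const_mul_field,
    iteratedDeriv_comp_affine k hq]
  simp only [iteratedDeriv_cexp_const_mul]
  rw [mul_one, neg_add_cancel, iteratedDeriv_expSlope_zero, stieltjesSeq, ofReal_sub, mul_sub,
    ofReal_sum, Finset.mul_sum]
  congr 1
  · refine Finset.sum_congr rfl fun m hm => ?_
    have hm : (0 : ℝ) < m := by exact_mod_cast (Finset.mem_Icc.1 hm).1
    rw [mul_one, exp_neg, ← ofReal_exp, Real.exp_log hm, neg_pow, ofReal_natCast]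
    push_cast
    ring
  · rw [neg_pow]
    push_cast
    ring

theorem tendsto_stieltjesSeq_ofReal (k : ℕ) :
    Tendsto (fun n => (stieltjesSeq k n : ℂ)) atTop
      (𝓝 ((-1) ^ k * iteratedDeriv k riemannZeta₀ 1)) := by
  have h := tendsto_iteratedDeriv_of_tendstoLocallyUniformlyOn
    (isOpen_lt continuous_const continuous_re)
    tendstoLocallyUniformlyOn_zetaPartial_riemannZeta₀
    (fun n => (differentiable_zetaPartial _).differentiableOn) k
    (show (1 : ℂ) ∈ {s : ℂ | 0 < s.re} by simp)
  refine (tendsto_add_atTop_iff_nat 1).1 ((h.const_mul ((-1) ^ k)).congr fun n => ?_)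
  rw [iteratedDeriv_zetaPartial_one, ← mul_assoc, ← mul_pow]
  simp

theorem tendsto_stieltjesSeq (k : ℕ) : Tendsto (stieltjesSeq k) atTop (𝓝 (stieltjes k)) :=
  tendsto_nhds_limUnder ⟨_, (continuous_re.tendsto _).comp (tendsto_stieltjesSeq_ofReal k)⟩

theorem iteratedDeriv_riemannZeta₀_one (k : ℕ) :
    iteratedDeriv k riemannZeta₀ 1 = (-1) ^ k * (stieltjes k : ℂ) := by
  have h := tendsto_nhds_unique ((continuous_ofReal.tendsto _).comp (tendsto_stieltjesSeq k))
    (tendsto_stieltjesSeq_ofReal k)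
  rw [h, ← mul_assoc, ← mul_pow]
  simp

end StieltjesExpansion

/-! ### Binomial identities for x + y = xy. -/

section Combinatorics

/-- A partial fraction expansion: replacing one factor xy by x + y lowers one exponent or the other,
and the coefficients follow Pascal's rule. -/
theorem pow_succ_mul_pow_succ_eq_sum {x y : ℂ} (h : x + y = x * y) (a b : ℕ) :
    x ^ (a + 1) * y ^ (b + 1) =
      ∑ i ∈ Finset.range (a + 1), ((a + b - i).choose b : ℂ) * x ^ (i + 1) +
      ∑ i ∈ Finset.range (b + 1), ((a + b - i).choose a : ℂ) * y ^ (i + 1) := by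
  induction a generalizing b with
  | zero =>
    induction b with
    | zero => simp [h]
    | succ b ih =>
      have e : x ^ (0 + 1) * y ^ (b + 1 + 1) = x ^ (0 + 1) * y ^ (b + 1) + y ^ (b + 1 + 1) := by
        linear_combination -y ^ (b + 1) * h
      rw [e, ih, Finset.sum_range_succ _ (b + 1)]
      simp
      ring
  | succ a iha =>
    induction b with
    | zero =>
      have e : x ^ (a + 1 + 1) * y ^ (0 + 1) = x ^ (a + 1) * y ^ (0 + 1) + x ^ (a + 1 + 1) := by
        linear_combination -x ^ (a + 1) * h
      rw [e, iha, Finset.sum_range_succ _ (a + 1)]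
      simp
      ring
    | succ b ihb =>
      have e : x ^ (a + 1 + 1) * y ^ (b + 1 + 1) =
          x ^ (a + 1 + 1) * y ^ (b + 1) + x ^ (a + 1) * y ^ (b + 1 + 1) := by
        linear_combination -x ^ (a + 1) * y ^ (b + 1) * h
      rw [e, ihb, iha]
      have e1 : ∑ i ∈ Finset.range (a + 1 + 1), ((a + 1 + (b + 1) - i).choose (b + 1) : ℂ) *
          x ^ (i + 1) = ∑ i ∈ Finset.range (a + 1 + 1), ((a + 1 + b - i).choose b : ℂ) *
          x ^ (i + 1) + ∑ i ∈ Finset.range (a + 1), ((a + (b + 1) - i).choose (b + 1) : ℂ) *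
          x ^ (i + 1) := by
        have hA : ∑ i ∈ Finset.range (a + 1), ((a + 1 + (b + 1) - i).choose (b + 1) : ℂ) *
            x ^ (i + 1) = ∑ i ∈ Finset.range (a + 1), ((a + 1 + b - i).choose b : ℂ) * x ^ (i + 1) +
            ∑ i ∈ Finset.range (a + 1), ((a + (b + 1) - i).choose (b + 1) : ℂ) * x ^ (i + 1) := by
          rw [← Finset.sum_add_distrib]
          refine Finset.sum_congr rfl fun i hi => ?_
          have hi : i ≤ a := by simpa [Nat.lt_succ_iff] using hi
          rw [show a + 1 + (b + 1) - i = (a + 1 + b - i) + 1 by omega,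
            show a + (b + 1) - i = a + 1 + b - i by omega, Nat.choose_succ_succ]
          push_cast; ring
        rw [Finset.sum_range_succ, Finset.sum_range_succ _ (a + 1), hA,
          show a + 1 + (b + 1) - (a + 1) = b + 1 by omega, show a + 1 + b - (a + 1) = b by omega,
          Nat.choose_self, Nat.choose_self]
        ring
      have e2 : ∑ i ∈ Finset.range (b + 1 + 1), ((a + 1 + (b + 1) - i).choose (a + 1) : ℂ) *
          y ^ (i + 1) = ∑ i ∈ Finset.range (b + 1), ((a + 1 + b - i).choose (a + 1) : ℂ) *
          y ^ (i + 1) + ∑ i ∈ Finset.range (b + 1 + 1), ((a + (b + 1) - i).choose a : ℂ) *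
          y ^ (i + 1) := by
        have hA : ∑ i ∈ Finset.range (b + 1), ((a + 1 + (b + 1) - i).choose (a + 1) : ℂ) *
            y ^ (i + 1) = ∑ i ∈ Finset.range (b + 1), ((a + 1 + b - i).choose (a + 1) : ℂ) *
            y ^ (i + 1) + ∑ i ∈ Finset.range (b + 1), ((a + (b + 1) - i).choose a : ℂ) *
            y ^ (i + 1) := by
          rw [← Finset.sum_add_distrib]
          refine Finset.sum_congr rfl fun i hi => ?_
          have hi : i ≤ b := by simpa [Nat.lt_succ_iff] using hi
          rw [show a + 1 + (b + 1) - i = (a + 1 + b - i) + 1 by omega,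
            show a + (b + 1) - i = a + 1 + b - i by omega, Nat.choose_succ_succ]
          push_cast; ring
        rw [Finset.sum_range_succ, Finset.sum_range_succ _ (b + 1), hA,
          show a + 1 + (b + 1) - (b + 1) = a + 1 by omega,
          show a + (b + 1) - (b + 1) = a by omega, Nat.choose_self, Nat.choose_self]
        ring
      rw [e1, e2]
      ring

theorem mul_pow_eq_sum_choose {x y : ℂ} (h : x + y = x * y) {m : ℕ} (hm : 1 ≤ m) :
    (x * y) ^ m = ∑ l ∈ Finset.range m,
      ((m + l - 1).choose (m - 1) : ℂ) * (x ^ (m - l) + y ^ (m - l)) := by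
  obtain ⟨a, rfl⟩ : ∃ a, m = a + 1 := ⟨m - 1, by omega⟩
  rw [mul_pow, pow_succ_mul_pow_succ_eq_sum h a a, ← Finset.sum_add_distrib,
    ← Finset.sum_range_reflect]
  refine Finset.sum_congr rfl fun l hl => ?_
  have hl : l ≤ a := by simpa [Nat.lt_succ_iff] using hl
  rw [show a + a - (a + 1 - 1 - l) = a + 1 + l - 1 by omega, show a + 1 - 1 = a by omega,
    show a - l + 1 = a + 1 - l by omega]
  ring

/-- `∑_{i + j = n} (-1)^i C(j, i) p^j`, which is `∑_{i + j = n} x^i y^j` if `p = x + y = x y`. -/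
noncomputable def chooseSum (p : ℂ) (n : ℕ) : ℂ :=
  ∑ ij ∈ Finset.HasAntidiagonal.antidiagonal n, (-1) ^ ij.1 * (ij.2.choose ij.1 : ℂ) * p ^ ij.2

/-- The recurrence of the complete homogeneous sums of the roots of t² - pt + p; here it is Pascal's
rule. -/
theorem chooseSum_add_two (p : ℂ) (n : ℕ) :
    chooseSum p (n + 2) = p * chooseSum p (n + 1) - p * chooseSum p n := by
  rw [chooseSum, chooseSum, chooseSum, Finset.Nat.antidiagonal_succ_succ',
    Finset.Nat.antidiagonal_succ]
  simp only [Finset.sum_cons, Finset.sum_map, Function.Embedding.prodMap,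
    Function.Embedding.coeFn_mk,
    Prod.map, Nat.succ_eq_add_one, Nat.choose_succ_succ, Nat.choose_zero_right,
    Nat.choose_zero_succ, Function.Embedding.refl_apply, Nat.cast_zero, Nat.cast_add, Nat.cast_one,
    mul_add, Finset.mul_sum, pow_zero, mul_zero, one_mul, zero_add, mul_one,
    add_mul, Finset.sum_add_distrib]
  have e1 : ∑ ij ∈ Finset.HasAntidiagonal.antidiagonal n,
      (-1 : ℂ) ^ (ij.1 + 1) * (ij.2.choose ij.1 : ℂ) * p ^ (ij.2 + 1) = -∑ ij ∈ Finset.HasAntidiagonal.antidiagonal n, p * ((-1) ^ ij.1 *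
      (ij.2.choose ij.1 : ℂ) * p ^ ij.2) := by
    rw [← Finset.sum_neg_distrib]
    exact Finset.sum_congr rfl fun _ _ => by ring
  have e2 : ∑ ij ∈ Finset.HasAntidiagonal.antidiagonal n,
      (-1 : ℂ) ^ (ij.1 + 1) * (ij.2.choose (ij.1 + 1) : ℂ) * p ^ (ij.2 + 1) = ∑ ij ∈ Finset.HasAntidiagonal.antidiagonal n, p * ((-1) ^ (ij.1 + 1) *
      (ij.2.choose (ij.1 + 1) : ℂ) * p ^ ij.2) :=
    Finset.sum_congr rfl fun _ _ => by ring
  rw [e1, e2]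
  ring

theorem pow_add_pow_eq_chooseSum {x y p : ℂ} (h1 : x + y = p) (h2 : x * y = p) (n : ℕ) :
    x ^ (n + 1) + y ^ (n + 1) = 2 * chooseSum p (n + 1) - p * chooseSum p n := by
  induction n using Nat.twoStepInduction with
  | zero =>
    simp [chooseSum, Finset.Nat.antidiagonal_succ, h1]
    ring
  | one =>
    rw [chooseSum_add_two]
    simp [chooseSum, Finset.Nat.antidiagonal_succ]
    linear_combination (x + y + p) * h1 - 2 * h2
  | more n ih1 ih2 =>
    have e : x ^ (n + 2 + 1) + y ^ (n + 2 + 1) =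
        p * (x ^ (n + 1 + 1) + y ^ (n + 1 + 1)) - p * (x ^ (n + 1) + y ^ (n + 1)) := by
      linear_combination (x ^ (n + 2) + y ^ (n + 2)) * h1 - (x ^ (n + 1) + y ^ (n + 1)) * h2
    have r1 := chooseSum_add_two p n
    have r2 := chooseSum_add_two p (n + 1)
    rw [e, ih1, ih2, show n + 2 + 1 = n + 1 + 2 by ring, r2, show n + 1 + 1 = n + 2 by ring]
    linear_combination p * r1

theorem chooseSum_eq_sum_range (p : ℂ) (n : ℕ) :
    chooseSum p n = ∑ l ∈ Finset.range (n / 2 + 1),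
      (-1) ^ l * ((n - l).choose l : ℂ) * p ^ (n - l) := by
  rw [chooseSum, Finset.Nat.sum_antidiagonal_eq_sum_range_succ_mk]
  refine (Finset.sum_subset (Finset.range_subset_range.2 (by omega)) fun l _ hl => ?_).symm
  rw [Nat.choose_eq_zero_of_lt (by simp at hl; omega)]
  simp

/-- Expanding the power sum by `pow_add_pow_eq_chooseSum` gives the coefficient 2 C(n-l, l) -
C(n-l-1, l), which equals n/(n-l) · C(n-l, l). -/
theorem pow_add_pow_div_eq_sum {x y : ℂ} (h : x + y = x * y) {n : ℕ} (hn : 1 ≤ n) :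
    (x ^ n + y ^ n) / n = ∑ l ∈ Finset.range (n / 2 + 1),
      (-1) ^ l * ((n - l).choose l : ℂ) * ((x * y) ^ (n - l) / ((n - l : ℕ) : ℂ)) := by
  obtain ⟨a, rfl⟩ : ∃ a, n = a + 1 := ⟨n - 1, by omega⟩
  obtain ⟨p, hp⟩ : ∃ p, p = x * y := ⟨_, rfl⟩
  rw [← hp] at h ⊢
  -- The range is enlarged to match the other sum; the added binomial coefficient, if any, is zero.
  have hsub : p * chooseSum p a = ∑ l ∈ Finset.range ((a + 1) / 2 + 1),
      (-1) ^ l * ((a - l).choose l : ℂ) * p ^ (a + 1 - l) := by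
    rw [chooseSum_eq_sum_range, Finset.mul_sum]
    have : Finset.range (a / 2 + 1) ⊆ Finset.range ((a + 1) / 2 + 1) :=
      Finset.range_subset_range.2 (by omega)
    rw [← Finset.sum_subset this fun l _ hl => by
      rw [Nat.choose_eq_zero_of_lt (by simp at *; omega)]; simp]
    refine Finset.sum_congr rfl fun l hl => ?_
    have : l ≤ a := by simp at hl; omega
    rw [show a + 1 - l = a - l + 1 by omega]
    ring
  rw [pow_add_pow_eq_chooseSum h hp.symm, hsub, chooseSum_eq_sum_range, Finset.mul_sum,
    ← Finset.sum_sub_distrib, Finset.sum_div]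
  refine Finset.sum_congr rfl fun l hl => ?_
  obtain ⟨b, rfl⟩ : ∃ b, a = l + b := ⟨a - l, by simp at hl; omega⟩
  rw [show l + b + 1 - l = b + 1 by omega, show l + b - l = b by omega]
  have hlb : l ≤ b + 1 := by simp at hl; omega
  have hc : ((b : ℂ) + 1) * (b.choose l : ℂ) = ((b + 1).choose l : ℂ) * ((b : ℂ) + 1 - l) := by
    have := congrArg (Nat.cast (R := ℂ)) (Nat.choose_mul_succ_eq b l)
    push_cast [Nat.cast_sub hlb] at this
    linear_combination this
  have hb : (b : ℂ) + 1 ≠ 0 := by exact_mod_cast b.succ_ne_zero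
  have hlb' : (l : ℂ) + b + 1 ≠ 0 := by exact_mod_cast (l + b).succ_ne_zero
  push_cast
  field_simp
  linear_combination (-p ^ (b + 1)) * hc

end Combinatorics

/-! ### Cumulants as Taylor coefficients of a logarithmic derivative. -/

section Cumulants

/-- `L` is the derivative of log(1 - g), and `P` truncates -log(1 - g). The geometric sum gives (L +
P')(1 - g) = -g' g^{n+1}, divisible by X^{n+1}; as 1 - g is a unit, L and -P' agree up to degree n.
-/
theorem coeff_of_mul_one_sub_eq_neg_derivative {g L : PowerSeries ℂ}
    (hg : PowerSeries.constantCoeff g = 0)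
    (hL : L * (1 - g) = -PowerSeries.derivative ℂ g) (n : ℕ) :
    PowerSeries.coeff n L = -((n : ℂ) + 1) *
      ∑ j ∈ Finset.Icc 1 (n + 1), PowerSeries.coeff (n + 1) (g ^ j) / (j : ℂ) := by
  set P : PowerSeries ℂ := ∑ j ∈ Finset.Icc 1 (n + 1), (j : ℂ)⁻¹ • g ^ j with hP
  have hdP : PowerSeries.derivative ℂ P * (1 - g) =
      PowerSeries.derivative ℂ g * (1 - g ^ (n + 1)) := by
    have h1 : PowerSeries.derivative ℂ P =
        (∑ j ∈ Finset.range (n + 1), g ^ j) * PowerSeries.derivative ℂ g := by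
      rw [hP, sum_Icc_one_eq_sum_range, map_sum, Finset.sum_mul]
      refine Finset.sum_congr rfl fun j _ => ?_
      rw [Derivation.map_smul, Derivation.leibniz_pow, Nat.add_sub_cancel,
        ← Nat.cast_smul_eq_nsmul ℂ,
        smul_smul, inv_mul_cancel₀ (Nat.cast_ne_zero.2 j.succ_ne_zero), one_smul, smul_eq_mul]
    rw [h1]
    linear_combination (-PowerSeries.derivative ℂ g) * geom_sum_mul g (n + 1)
  have hdvd : PowerSeries.X ^ (n + 1) ∣ (L + PowerSeries.derivative ℂ P) * (1 - g) := by
    have : (L + PowerSeries.derivative ℂ P) * (1 - g) =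
        -PowerSeries.derivative ℂ g * g ^ (n + 1) := by
      rw [add_mul, hL, hdP]; ring
    rw [this]
    exact Dvd.dvd.mul_left (pow_dvd_pow_of_dvd (PowerSeries.X_dvd_iff.2 hg) _) _
  have hu : IsUnit (1 - g) := by
    rw [PowerSeries.isUnit_iff_constantCoeff]
    simp [hg]
  rw [hu.dvd_mul_right] at hdvd
  have h0 := PowerSeries.X_pow_dvd_iff.1 hdvd n (by omega)
  rw [map_add, PowerSeries.coeff_derivative] at h0
  have h1 : PowerSeries.coeff (n + 1) P =
      ∑ j ∈ Finset.Icc 1 (n + 1), PowerSeries.coeff (n + 1) (g ^ j) / (j : ℂ) := by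
    rw [hP, map_sum]
    refine Finset.sum_congr rfl fun j _ => ?_
    rw [PowerSeries.coeff_smul, smul_eq_mul, div_eq_inv_mul]
  rw [← h1]
  linear_combination h0

/-- The Taylor series of `f` at `0`. -/
noncomputable def taylorSeries (f : ℂ → ℂ) : PowerSeries ℂ :=
  PowerSeries.mk fun n => iteratedDeriv n f 0 / n.factorial

theorem taylorSeries_mul {f g : ℂ → ℂ} (hf : AnalyticAt ℂ f 0) (hg : AnalyticAt ℂ g 0) :
    taylorSeries (f * g) = taylorSeries f * taylorSeries g := by
  ext n
  rw [PowerSeries.coeff_mul, Finset.Nat.sum_antidiagonal_eq_sum_range_succ_mk]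
  simp only [taylorSeries, PowerSeries.coeff_mk]
  rw [iteratedDeriv_mul hf.contDiffAt hg.contDiffAt, Finset.sum_div]
  refine Finset.sum_congr rfl fun i hi => ?_
  have hi : i ≤ n := by simpa [Nat.lt_succ_iff] using hi
  rw [Nat.cast_choose ℂ hi]
  have h1 : (n.factorial : ℂ) ≠ 0 := Nat.cast_ne_zero.2 n.factorial_ne_zero
  field_simp

theorem taylorSeries_deriv (f : ℂ → ℂ) :
    taylorSeries (deriv f) = PowerSeries.derivative ℂ (taylorSeries f) := by
  ext n
  rw [PowerSeries.coeff_derivative]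
  simp only [taylorSeries, PowerSeries.coeff_mk]
  have h1 : (n : ℂ) + 1 ≠ 0 := by exact_mod_cast n.succ_ne_zero
  have h2 : (n.factorial : ℂ) ≠ 0 := Nat.cast_ne_zero.2 n.factorial_ne_zero
  rw [iteratedDeriv_succ', Nat.factorial_succ]
  push_cast
  field_simp

theorem taylorSeries_congr {f g : ℂ → ℂ} (h : f =ᶠ[𝓝 0] g) : taylorSeries f = taylorSeries g := by
  ext n
  simp only [taylorSeries, PowerSeries.coeff_mk, h.iteratedDeriv_eq]

/-- With x = 1 - s, (s-1)ζ(s) = 1 - x (ζ(s) - 1/(s-1)), and the sign (-1)^k of the Taylor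
coefficients at s = 1 cancels against the reflection. -/
theorem taylorSeries_riemannZeta₁ :
    taylorSeries (fun x => riemannZeta₁ (-1 * x + 1)) =
      1 - PowerSeries.map Complex.ofRealHom stieltjesSeries := by
  have hz : AnalyticAt ℂ riemannZeta₀ (-1 * 0 + 1) := differentiable_riemannZeta₀.analyticAt _
  have hz' : AnalyticAt ℂ (fun x => riemannZeta₀ (-1 * x + 1)) 0 :=
    AnalyticAt.fun_comp (f := fun x : ℂ => -1 * x + 1) hz (by fun_prop)
  have h1 : (fun x => riemannZeta₁ (-1 * x + 1)) = (fun _ => 1) -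
      id * fun x => riemannZeta₀ (-1 * x + 1) := by
    ext x
    simp only [riemannZeta₁, Pi.sub_apply, Pi.mul_apply, id]
    ring
  have h2 : taylorSeries id = PowerSeries.X := by
    ext n
    simp only [taylorSeries, PowerSeries.coeff_mk, PowerSeries.coeff_X, iteratedDeriv_id]
    split_ifs with h3 h4 <;> simp_all
  have h3 : taylorSeries (id * fun x => riemannZeta₀ (-1 * x + 1)) =
      PowerSeries.map Complex.ofRealHom stieltjesSeries := by
    rw [taylorSeries_mul analyticAt_id hz', h2]
    ext n
    rcases n with _ | n
    · simp [stieltjesSeries]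
    · rw [PowerSeries.coeff_succ_X_mul]
      simp only [taylorSeries, stieltjesSeries, PowerSeries.coeff_mk, PowerSeries.coeff_map]
      rw [iteratedDeriv_comp_affine n hz, mul_zero, zero_add, iteratedDeriv_riemannZeta₀_one,
        ← mul_assoc, ← mul_pow]
      simp
  rw [← h3, h1]
  ext n
  rw [map_sub]
  simp only [taylorSeries, PowerSeries.coeff_mk, PowerSeries.coeff_one]
  rw [iteratedDeriv_sub contDiffAt_const (analyticAt_id.mul hz').contDiffAt, iteratedDeriv_const,
    sub_div]
  congr 1
  split_ifs with h0 <;> simp [h0]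

theorem iteratedDeriv_logDeriv_riemannZeta₁ (n : ℕ) :
    iteratedDeriv n (logDeriv riemannZeta₁) 1 =
      (-1) ^ n * (((n : ℂ) + 1) * (stieltjesCumulant n : ℂ)) := by
  have hz : AnalyticAt ℂ riemannZeta₁ (-1 * 0 + 1) := differentiable_riemannZeta₁.analyticAt _
  set φ : ℂ → ℂ := fun x => riemannZeta₁ (-1 * x + 1) with hφ
  have hφa : AnalyticAt ℂ φ 0 :=
    AnalyticAt.fun_comp (f := fun x : ℂ => -1 * x + 1) hz (by fun_prop)
  have hφ0 : φ 0 ≠ 0 := by simp [hφ]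
  have h1 : deriv φ =ᶠ[𝓝 0] logDeriv φ * φ := by
    filter_upwards [hφa.continuousAt.eventually_ne hφ0] with x hx
    rw [Pi.mul_apply, logDeriv_apply, div_mul_cancel₀ _ hx]
  have h2 := taylorSeries_congr h1
  rw [taylorSeries_mul (analyticAt_logDeriv hφa hφ0) hφa, taylorSeries_deriv,
    taylorSeries_riemannZeta₁, map_sub, PowerSeries.derivative_one, zero_sub] at h2
  have h3 := coeff_of_mul_one_sub_eq_neg_derivative (by
    rw [← PowerSeries.coeff_zero_eq_constantCoeff_apply, PowerSeries.coeff_map]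
    simp [stieltjesSeries]) h2.symm n
  have h4 : ∀ j, PowerSeries.coeff (n + 1) (PowerSeries.map Complex.ofRealHom stieltjesSeries ^ j) =
      ((PowerSeries.coeff (n + 1) (stieltjesSeries ^ j) : ℝ) : ℂ) := fun j => by
    rw [← map_pow, PowerSeries.coeff_map, Complex.ofRealHom_eq_coe]
  simp only [h4, taylorSeries, PowerSeries.coeff_mk] at h3
  rw [iteratedDeriv_logDeriv_comp_affine n hz (by simp), mul_zero, zero_add] at h3
  have hf : (n.factorial : ℂ) ≠ 0 := Nat.cast_ne_zero.2 n.factorial_ne_zero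
  have hs : ((-1 : ℂ) ^ n) * (-1) ^ n = 1 := by rw [← mul_pow]; simp
  rw [div_eq_iff hf, pow_succ] at h3
  rw [stieltjesCumulant]
  push_cast
  linear_combination (-(-1) ^ n) * h3 - iteratedDeriv n (logDeriv riemannZeta₁) 1 * hs

end Cumulants

/-! ### Convergence of the sums over zeros: from discs to |Im ρ| ≤ T. -/

section ZeroSums

theorem mem_zerosUpTo {T : ℝ} {ρ : ℂ} :
    ρ ∈ zerosUpTo T ↔ ρ ∈ nontrivialZeros ∧ |ρ.im| ≤ T := by
  simp [zerosUpTo]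

theorem im_ne_zero_of_mem_nontrivialZeros {ρ : ℂ} (h : ρ ∈ nontrivialZeros) : ρ.im ≠ 0 := by
  intro h0
  have e : ρ = (ρ.re : ℂ) := Complex.ext rfl (by simpa using h0)
  exact riemannZeta_ne_zero_of_mem_Ioo ⟨h.2.1, h.2.2⟩ (e ▸ h.1)

theorem ne_zero_of_mem_nontrivialZeros {ρ : ℂ} (h : ρ ∈ nontrivialZeros) : ρ ≠ 0 := by
  rintro rfl
  simpa using h.2.1

theorem one_sub_ne_zero_of_mem_nontrivialZeros {ρ : ℂ} (h : ρ ∈ nontrivialZeros) : 1 - ρ ≠ 0 :=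
  ne_zero_of_mem_nontrivialZeros (one_sub_mem_nontrivialZeros h)

open Classical in
/-- The nontrivial zeros in the closed disc of radius `R` about `1 / 2`. -/
noncomputable def zerosInBall (R : ℝ) : Finset ℂ :=
  {ρ ∈ zerosUpTo R | ‖ρ - 1 / 2‖ ≤ R}

theorem mem_zerosInBall {R : ℝ} {ρ : ℂ} :
    ρ ∈ zerosInBall R ↔ ρ ∈ nontrivialZeros ∧ ‖ρ - 1 / 2‖ ≤ R := by
  simp only [zerosInBall, Finset.mem_filter, mem_zerosUpTo, and_assoc]
  refine ⟨fun h => ⟨h.1, h.2.2⟩, fun h => ⟨h.1, ?_, h.2⟩⟩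
  have := Complex.abs_im_le_norm (ρ - 1 / 2)
  have e : (ρ - 1 / 2).im = ρ.im := by simp
  rw [e] at this
  exact this.trans h.2

/-- A nested family of finite sets of nontrivial zeros, stable under `ρ ↦ 1 - ρ`, that exhausts
the nontrivial zeros. -/
structure Exhausts (S : ℝ → Finset ℂ) : Prop where
  mono : Monotone S
  sub : ∀ R, ∀ ρ ∈ S R, ρ ∈ nontrivialZeros
  exists_mem : ∀ ρ ∈ nontrivialZeros, ∃ R, ρ ∈ S R
  one_sub_mem : ∀ R, ∀ ρ ∈ S R, 1 - ρ ∈ S R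

theorem exhausts_zerosUpTo : Exhausts zerosUpTo where
  mono R R' h ρ hρ := by
    rw [mem_zerosUpTo] at *
    exact ⟨hρ.1, hρ.2.trans h⟩
  sub R ρ hρ := (mem_zerosUpTo.1 hρ).1
  exists_mem ρ hρ := ⟨_, mem_zerosUpTo.2 ⟨hρ, le_rfl⟩⟩
  one_sub_mem R ρ hρ := by
    rw [mem_zerosUpTo] at *
    exact ⟨one_sub_mem_nontrivialZeros hρ.1, by simpa using hρ.2⟩

theorem exhausts_zerosInBall : Exhausts zerosInBall where
  mono R R' h ρ hρ := by
    rw [mem_zerosInBall] at *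
    exact ⟨hρ.1, hρ.2.trans h⟩
  sub R ρ hρ := (mem_zerosInBall.1 hρ).1
  exists_mem ρ hρ := ⟨_, mem_zerosInBall.2 ⟨hρ, le_rfl⟩⟩
  one_sub_mem R ρ hρ := by
    rw [mem_zerosInBall] at *
    refine ⟨one_sub_mem_nontrivialZeros hρ.1, ?_⟩
    rw [show 1 - ρ - 1 / 2 = -(ρ - 1 / 2) by ring, norm_neg]
    exact hρ.2

theorem Exhausts.tendsto_sum {S : ℝ → Finset ℂ} (hS : Exhausts S) {G : ℂ → ℂ}
    (hG : Summable fun ρ : nontrivialZeros => G ρ) :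
    Tendsto (fun R => ∑ ρ ∈ S R, G ρ) atTop (𝓝 (∑' ρ : nontrivialZeros, G ρ)) := by
  classical
  have h1 : Tendsto (fun R => (S R).subtype (· ∈ nontrivialZeros)) atTop atTop := by
    refine tendsto_atTop_finset_of_monotone (fun R R' h => ?_) fun ρ => ?_
    · exact Finset.subtype_mono (hS.mono h)
    · obtain ⟨R, hR⟩ := hS.exists_mem ρ ρ.2
      exact ⟨R, Finset.mem_subtype.2 hR⟩
  refine (hG.hasSum.comp h1).congr fun R => ?_
  exact Finset.sum_subtype_of_mem G (hS.sub R)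

theorem Exhausts.sum_mult_one_sub {S : ℝ → Finset ℂ} (hS : Exhausts S) (R : ℝ) (h : ℂ → ℂ) :
    ∑ ρ ∈ S R, (mult ρ : ℂ) * h (1 - ρ) = ∑ ρ ∈ S R, (mult ρ : ℂ) * h ρ := by
  refine Finset.sum_nbij' (fun ρ => 1 - ρ) (fun ρ => 1 - ρ) (hS.one_sub_mem R) (hS.one_sub_mem R)
    (by simp) (by simp) fun ρ hρ => ?_
  rw [mult_one_sub (hS.sub R ρ hρ)]

/-- The limit of the sums of `ρ ^ (-n)` over discs. -/
theorem tendsto_sum_zerosInBall (k : ℕ) :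
    Tendsto (fun R => ∑ ρ ∈ zerosInBall R, (mult ρ : ℂ) * (ρ ^ (k + 1))⁻¹) atTop
      (𝓝 (-(iteratedDeriv k (logDeriv xi) 0 / k.factorial))) := by
  obtain ⟨L, hL⟩ := exists_norm_xi_le
  -- Centred at 1/2, ξ is even; the point s = 0 becomes w = -1/2.
  set f : ℂ → ℂ := fun w => xi (1 * w + 1 / 2) with hf
  have hfd : Differentiable ℂ f := by
    have := differentiable_xi
    fun_prop
  have hxi : AnalyticAt ℂ xi (1 * (-1 / 2) + 1 / 2) := differentiable_xi.analyticAt _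
  have h0 : f 0 ≠ 0 := by
    simp only [hf, mul_zero, zero_add]
    rw [Ne, xi_eq_zero_iff]
    intro h
    -- ξ(1/2) ≠ 0 because ζ has no real zero in (0,1).
    exact im_ne_zero_of_mem_nontrivialZeros h (by norm_num)
  have hz : f (-1 / 2) ≠ 0 := by
    simp only [hf]
    norm_num [xi_zero]
  have key := tendsto_sum_zeros_iteratedDeriv_logDeriv hfd (fun w => by
    simp only [hf]
    rw [← xi_one_sub]
    ring_nf) h0 (fun R hR w hw => by
      have := hL R hR w hw
      simpa only [hf, one_mul, add_comm] using this) (tendsto_growth_div_sq L)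
    (fun R => (zerosInBall R).map (addRightEmbedding (-(1 / 2)))) (fun R a => by
      simp only [Finset.mem_map, addRightEmbedding_apply, mem_zerosInBall, hf]
      constructor
      · rintro ⟨ρ, ⟨h1, h2⟩, rfl⟩
        refine ⟨?_, by simpa only [sub_eq_add_neg] using h2⟩
        rw [xi_eq_zero_iff]
        simpa using h1
      · rintro ⟨h1, h2⟩
        rw [xi_eq_zero_iff] at h1
        refine ⟨1 * a + 1 / 2, ⟨h1, ?_⟩, by ring⟩
        simpa using h2) k hz
  rw [iteratedDeriv_logDeriv_comp_affine k hxi (by norm_num [xi_zero])] at key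
  have hf0 : (k.factorial : ℂ) ≠ 0 := Nat.cast_ne_zero.2 k.factorial_ne_zero
  have key2 := key.mul_const (-(k.factorial : ℂ)⁻¹)
  have e0 : (1 : ℂ) * (-1 / 2) + 1 / 2 = 0 := by norm_num
  rw [e0, one_pow, one_mul, mul_neg, ← div_eq_mul_inv] at key2
  refine key2.congr fun R => ?_
  rw [Finset.sum_map, Finset.sum_mul]
  refine Finset.sum_congr rfl fun ρ hρ => ?_
  have hm : analyticOrderNatAt f (addRightEmbedding (-(1 / 2)) ρ) = mult ρ := by
    rw [← analyticOrderNatAt_xi (mem_zerosInBall.1 hρ).1]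
    simp only [analyticOrderNatAt, hf]
    rw [analyticOrderAt_comp_affine 1 (1 / 2) _ one_ne_zero]
    simp
  have hρ0 := ne_zero_of_mem_nontrivialZeros (mem_zerosInBall.1 hρ).1
  rw [hm, addRightEmbedding_apply, show -1 / 2 - (ρ + -(1 / 2)) = -1 * ρ by ring, mul_pow, mul_inv,
    ← inv_pow, pow_succ (-1 : ℂ)⁻¹, inv_neg, inv_one]
  have hs : ((-1 : ℂ) ^ k) * (-1) ^ k = 1 := by rw [← mul_pow]; simp
  field_simp
  linear_combination (mult ρ : ℂ) * hs

/-- The summand `(ρ (1 - ρ)) ^ (-m)` with its multiplicity. -/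
noncomputable def pairTerm (m : ℕ) (ρ : ℂ) : ℂ :=
  (mult ρ : ℂ) * ((ρ * (1 - ρ)) ^ m)⁻¹

theorem re_mul_one_sub (ρ : ℂ) : (ρ * (1 - ρ)).re = ρ.re * (1 - ρ.re) + ρ.im ^ 2 := by
  simp
  ring

theorem re_mul_one_sub_pos {ρ : ℂ} (h : ρ ∈ nontrivialZeros) : 0 < (ρ * (1 - ρ)).re := by
  have h1 := h.2.1
  have h2 : 0 < 1 - ρ.re := by linarith [h.2.2]
  rw [re_mul_one_sub]
  positivity

/-- The imaginary part is Im ρ · (1 - 2 Re ρ), at most |Im ρ| ≤ (Im ρ)² in modulus, hence at most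
the real part. -/
theorem norm_mul_one_sub_le {ρ : ℂ} (h : ρ ∈ nontrivialZeros) (h1 : 1 ≤ |ρ.im|) :
    ‖ρ * (1 - ρ)‖ ≤ 2 * (ρ * (1 - ρ)).re := by
  have h2 := Complex.norm_le_abs_re_add_abs_im (ρ * (1 - ρ))
  have h3 : |(ρ * (1 - ρ)).im| ≤ (ρ * (1 - ρ)).re := by
    have e : (ρ * (1 - ρ)).im = ρ.im * (1 - 2 * ρ.re) := by
      simp
      ring
    rw [e, abs_mul, re_mul_one_sub]
    have h4 : |1 - 2 * ρ.re| ≤ 1 := abs_le.2 ⟨by linarith [h.2.2], by linarith [h.2.1]⟩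
    have h5 : 0 < ρ.re * (1 - ρ.re) := mul_pos h.2.1 (by linarith [h.2.2])
    have h6 : ρ.im ^ 2 = |ρ.im| * |ρ.im| := by rw [← sq, sq_abs]
    nlinarith [abs_nonneg (1 - 2 * ρ.re)]
  rw [abs_of_pos (re_mul_one_sub_pos h)] at h2
  linarith

theorem eventually_one_le_abs_im :
    ∀ᶠ ρ : nontrivialZeros in cofinite, 1 ≤ |(ρ : ℂ).im| := by
  rw [eventually_cofinite]
  refine Set.Finite.subset ((finite_zeros_of_height_le 1).preimage
    (Subtype.val_injective.injOn)) fun ρ hρ => ?_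
  exact ⟨ρ.2, (not_le.1 hρ).le⟩

theorem Exhausts.sum_pairTerm_one {S : ℝ → Finset ℂ} (hS : Exhausts S) (R : ℝ) :
    ∑ ρ ∈ S R, pairTerm 1 ρ = 2 * ∑ ρ ∈ S R, (mult ρ : ℂ) * (ρ ^ 1)⁻¹ := by
  rw [two_mul]
  nth_rw 2 [← hS.sum_mult_one_sub R fun ρ => (ρ ^ 1)⁻¹]
  rw [← Finset.sum_add_distrib]
  refine Finset.sum_congr rfl fun ρ hρ => ?_
  have h0 := ne_zero_of_mem_nontrivialZeros (hS.sub R ρ hρ)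
  have h1 := one_sub_ne_zero_of_mem_nontrivialZeros (hS.sub R ρ hρ)
  rw [pairTerm]
  field_simp
  ring

/-- The real parts are nonnegative and their sums over growing discs converge, so every finite sum
is below that limit. For all but finitely many zeros the norm is at most twice the real part. -/
theorem summable_pairTerm_one : Summable fun ρ : nontrivialZeros => pairTerm 1 ρ := by
  classical
  have hre : ∀ ρ ∈ nontrivialZeros, (pairTerm 1 ρ).re =
      mult ρ * ((ρ * (1 - ρ)).re / ‖ρ * (1 - ρ)‖ ^ 2) := fun ρ _ => by
    rw [pairTerm, pow_one, ← Complex.ofReal_natCast, Complex.re_ofReal_mul, Complex.inv_re,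
      Complex.normSq_eq_norm_sq]
  have hnn : ∀ ρ ∈ nontrivialZeros, 0 ≤ (pairTerm 1 ρ).re := fun ρ hρ => by
    rw [hre ρ hρ]
    have := re_mul_one_sub_pos hρ
    positivity
  have hlim := (tendsto_sum_zerosInBall 0).const_mul 2
  simp only [zero_add, ← exhausts_zerosInBall.sum_pairTerm_one] at hlim
  have hlim2 := (Complex.continuous_re.tendsto _).comp hlim
  have hmono : Monotone (Complex.re ∘ fun R => ∑ ρ ∈ zerosInBall R, pairTerm 1 ρ) := by
    intro R R' h
    simp only [Function.comp_apply, Complex.re_sum]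
    exact Finset.sum_le_sum_of_subset_of_nonneg (exhausts_zerosInBall.mono h) fun ρ hρ _ =>
      hnn ρ (exhausts_zerosInBall.sub R' ρ hρ)
  have hsum : Summable fun ρ : nontrivialZeros => (pairTerm 1 ρ).re := by
    refine summable_of_sum_le (fun ρ => hnn ρ ρ.2)
      (c := (2 * -(iteratedDeriv 0 (logDeriv xi) 0 / (Nat.factorial 0 : ℂ))).re) fun u => ?_
    have hu : ∃ R, ∀ ρ ∈ u, (ρ : ℂ) ∈ zerosInBall R := by
      refine ⟨∑ ρ ∈ u, ‖(ρ : ℂ) - 1 / 2‖, fun ρ hρ => mem_zerosInBall.2 ⟨ρ.2, ?_⟩⟩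
      exact Finset.single_le_sum (f := fun ρ : nontrivialZeros => ‖(ρ : ℂ) - 1 / 2‖)
        (fun _ _ => norm_nonneg _) hρ
    obtain ⟨R, hR⟩ := hu
    refine le_trans ?_ (hmono.ge_of_tendsto hlim2 R)
    rw [Function.comp_apply, Complex.re_sum,
      ← Finset.sum_subtype_of_mem (fun ρ => (pairTerm 1 ρ).re) (exhausts_zerosInBall.sub R)]
    exact Finset.sum_le_sum_of_subset_of_nonneg (fun ρ hρ => Finset.mem_subtype.2 (hR ρ hρ))
      fun ρ _ _ => hnn ρ ρ.2
  refine Summable.of_norm_bounded_eventually (hsum.mul_left 2) ?_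
  filter_upwards [eventually_one_le_abs_im] with ρ h1
  have h2 := norm_mul_one_sub_le ρ.2 h1
  have h3 : 0 < ‖(ρ : ℂ) * (1 - ρ)‖ := norm_pos_iff.2 (mul_ne_zero
    (ne_zero_of_mem_nontrivialZeros ρ.2) (one_sub_ne_zero_of_mem_nontrivialZeros ρ.2))
  rw [hre ρ ρ.2, pairTerm, pow_one, norm_mul, Complex.norm_natCast, norm_inv,
    show (2 : ℝ) * (mult ρ * (((ρ : ℂ) * (1 - ρ)).re / ‖(ρ : ℂ) * (1 - ρ)‖ ^ 2)) =
      mult ρ * (2 * ((ρ : ℂ) * (1 - ρ)).re / ‖(ρ : ℂ) * (1 - ρ)‖ ^ 2) by ring]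
  refine mul_le_mul_of_nonneg_left ?_ (Nat.cast_nonneg _)
  rw [le_div_iff₀ (by positivity), sq, ← mul_assoc, inv_mul_cancel₀ h3.ne', one_mul]
  exact h2

theorem one_le_norm_of_one_le_abs_im {z : ℂ} (h : 1 ≤ |z.im|) : 1 ≤ ‖z‖ :=
  h.trans (Complex.abs_im_le_norm z)

theorem summable_pairTerm {m : ℕ} (hm : 1 ≤ m) :
    Summable fun ρ : nontrivialZeros => pairTerm m ρ := by
  refine Summable.of_norm_bounded_eventually summable_pairTerm_one.norm ?_
  filter_upwards [eventually_one_le_abs_im] with ρ h1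
  have h2 : 1 ≤ ‖(ρ : ℂ) * (1 - ρ)‖ := by
    rw [norm_mul]
    exact one_le_mul_of_one_le_of_one_le (one_le_norm_of_one_le_abs_im h1)
      (one_le_norm_of_one_le_abs_im (by simpa using h1))
  simp only [pairTerm, norm_mul (mult (ρ : ℂ) : ℂ), norm_inv, norm_pow]
  gcongr

/-- When |Im ρ| ≥ 1, |1 - ρ| ≤ 2|ρ|, so |ρ|^{-n} ≤ |ρ|^{-2} ≤ 2 / |ρ(1 - ρ)|. -/
theorem summable_mult_mul_inv_pow {n : ℕ} (hn : 2 ≤ n) :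
    Summable fun ρ : nontrivialZeros => (mult (ρ : ℂ) : ℂ) * ((ρ : ℂ) ^ n)⁻¹ := by
  refine Summable.of_norm_bounded_eventually (summable_pairTerm_one.norm.mul_left 2) ?_
  filter_upwards [eventually_one_le_abs_im] with ρ h1
  have h2 := one_le_norm_of_one_le_abs_im h1
  have h3 : ‖1 - (ρ : ℂ)‖ ≤ 2 * ‖(ρ : ℂ)‖ := by
    refine (norm_sub_le _ _).trans ?_
    rw [norm_one]
    linarith
  have h4 : 0 < ‖1 - (ρ : ℂ)‖ := norm_pos_iff.2 (one_sub_ne_zero_of_mem_nontrivialZeros ρ.2)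
  simp only [pairTerm, pow_one, norm_mul, norm_inv, norm_pow, Complex.norm_natCast]
  rw [mul_left_comm]
  refine mul_le_mul_of_nonneg_left ?_ (Nat.cast_nonneg _)
  have h5 : ‖(ρ : ℂ)‖ ^ 2 ≤ ‖(ρ : ℂ)‖ ^ n := pow_le_pow_right₀ h2 hn
  rw [← div_eq_mul_inv, inv_eq_one_div, div_le_div_iff₀ (by positivity) (by positivity)]
  nlinarith

/-- Sums over discs and over heights have the same limit where there is absolute convergence. For
exponent 1 this is available only after symmetrizing under ρ ↦ 1 - ρ. -/
theorem tendsto_partialZ_aux (k : ℕ) :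
    Tendsto (partialZ (k + 1)) atTop (𝓝 (-(iteratedDeriv k (logDeriv xi) 0 / k.factorial))) := by
  rcases k with _ | k
  · have h1 := exhausts_zerosInBall.tendsto_sum summable_pairTerm_one
    have h2 := exhausts_zerosUpTo.tendsto_sum summable_pairTerm_one
    simp only [Exhausts.sum_pairTerm_one exhausts_zerosInBall] at h1
    simp only [Exhausts.sum_pairTerm_one exhausts_zerosUpTo] at h2
    have h3 := tendsto_nhds_unique h1 ((tendsto_sum_zerosInBall 0).const_mul 2)
    rw [h3] at h2
    have h4 := h2.const_mul (1 / 2)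
    simp only [← mul_assoc] at h4
    norm_num at h4
    simpa [show partialZ 1 = fun T => ∑ ρ ∈ zerosUpTo T, (mult ρ : ℂ) * (ρ ^ 1)⁻¹ from rfl]
      using h4
  · have hs := summable_mult_mul_inv_pow (n := k + 1 + 1) (by omega)
    have h1 := exhausts_zerosInBall.tendsto_sum
      (G := fun ρ => (mult ρ : ℂ) * (ρ ^ (k + 1 + 1))⁻¹) hs
    have h2 := exhausts_zerosUpTo.tendsto_sum (G := fun ρ => (mult ρ : ℂ) * (ρ ^ (k + 1 + 1))⁻¹) hs
    rw [tendsto_nhds_unique h1 (tendsto_sum_zerosInBall (k + 1))] at h2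
    exact h2

theorem scrZ_succ (k : ℕ) :
    scrZ (k + 1) = -(iteratedDeriv k (logDeriv xi) 0 / k.factorial) :=
  (tendsto_partialZ_aux k).limUnder_eq

theorem tendsto_partialZ {n : ℕ} (hn : 1 ≤ n) : Tendsto (partialZ n) atTop (𝓝 (scrZ n)) := by
  obtain ⟨k, rfl⟩ := Nat.exists_eq_add_of_le' hn
  rw [scrZ_succ]
  exact tendsto_partialZ_aux k

theorem hasSum_scrZ {n : ℕ} (hn : 2 ≤ n) :
    HasSum (fun ρ : nontrivialZeros => (mult (ρ : ℂ) : ℂ) * ((ρ : ℂ) ^ n)⁻¹) (scrZ n) := by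
  have hs := summable_mult_mul_inv_pow hn
  have h := exhausts_zerosUpTo.tendsto_sum (G := fun ρ => (mult ρ : ℂ) * (ρ ^ n)⁻¹) hs
  rw [← tendsto_nhds_unique h (tendsto_partialZ (by omega))]
  exact hs.hasSum

end ZeroSums

/-! ### Relations between Z(m) and 𝒵_n. -/

section TauSums

theorem half_add_I_mul_im (τ : ℂ) : (1 / 2 + Complex.I * τ).im = τ.re := by simp

theorem one_sub_half_add (τ : ℂ) :
    1 - (1 / 2 + Complex.I * τ) = 1 / 2 + Complex.I * -τ := by ring

/-- The nontrivial zeros are the numbers `1 / 2 ± i τ`. -/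
theorem bijective_tau :
    Function.Bijective (Sum.elim
      (fun τ : tauSet => (⟨1 / 2 + Complex.I * τ, τ.2.2⟩ : nontrivialZeros))
      fun τ : tauSet => ⟨1 - (1 / 2 + Complex.I * τ), one_sub_mem_nontrivialZeros τ.2.2⟩) := by
  constructor
  · rintro (a | a) (b | b) h <;> simp only [Sum.elim_inl, Sum.elim_inr, Subtype.mk.injEq] at h
    · congr 1
      exact Subtype.ext (mul_left_cancel₀ Complex.I_ne_zero (add_left_cancel h))
    · rw [one_sub_half_add] at h
      have e : (a : ℂ) = -b := mul_left_cancel₀ Complex.I_ne_zero (add_left_cancel h)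
      have := a.2.1
      have := b.2.1
      rw [e, Complex.neg_re] at *
      linarith
    · rw [one_sub_half_add] at h
      have e : -(a : ℂ) = b := mul_left_cancel₀ Complex.I_ne_zero (add_left_cancel h)
      have h1 := a.2.1
      have h2 := b.2.1
      rw [← e, Complex.neg_re] at h2
      linarith
    · congr 1
      exact Subtype.ext (mul_left_cancel₀ Complex.I_ne_zero
        (add_left_cancel (sub_right_injective h)))
  · rintro ⟨ρ, hρ⟩
    have key : ∀ ρ : ℂ, 1 / 2 + Complex.I * (-Complex.I * (ρ - 1 / 2)) = ρ := fun ρ => by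
      linear_combination (-(ρ - 1 / 2)) * Complex.I_mul_I
    have hre : ∀ ρ : ℂ, (-Complex.I * (ρ - 1 / 2)).re = ρ.im := fun ρ => by
      rw [← half_add_I_mul_im, key]
    -- Re τ is the imaginary part of 1/2 + iτ, so the sign of Im ρ decides which member of the pair
    -- ρ is.
    rcases lt_or_gt_of_ne (im_ne_zero_of_mem_nontrivialZeros hρ) with h | h
    · refine ⟨Sum.inr ⟨-Complex.I * (1 - ρ - 1 / 2), ?_, ?_⟩, ?_⟩
      · rw [hre]
        simpa using h
      · rw [key]
        exact one_sub_mem_nontrivialZeros hρ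
      · simp only [Sum.elim_inr, Subtype.mk.injEq, key]
        ring
    · refine ⟨Sum.inl ⟨-Complex.I * (ρ - 1 / 2), ?_, ?_⟩, ?_⟩
      · rwa [hre]
      · rwa [key]
      · simp only [Sum.elim_inl, key]

/-- For ρ = 1/2 + iτ, ρ(1 - ρ) = τ² + 1/4. -/
theorem zetaTerm_natCast (m : ℕ) (τ : tauSet) :
    zetaTerm m (1 / 4) τ = pairTerm m (1 / 2 + Complex.I * τ) := by
  rw [zetaTerm, pairTerm, Complex.cpow_neg, Complex.cpow_natCast]
  congr 3
  push_cast
  linear_combination ((τ : ℂ) ^ 2) * Complex.I_mul_I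

theorem pairTerm_one_sub (m : ℕ) {ρ : ℂ} (h : ρ ∈ nontrivialZeros) :
    pairTerm m (1 - ρ) = pairTerm m ρ := by
  rw [pairTerm, pairTerm, mult_one_sub h, sub_sub_cancel, mul_comm ρ]

theorem summable_zetaTerm {m : ℕ} (hm : 1 ≤ m) : Summable (zetaTerm m (1 / 4)) := by
  have h := (summable_pairTerm hm).comp_injective
    (bijective_tau.injective.comp Sum.inl_injective)
  exact h.congr fun τ => (zetaTerm_natCast m τ).symm

theorem hasSum_pairTerm {m : ℕ} (hm : 1 ≤ m) :
    HasSum (fun ρ : nontrivialZeros => pairTerm m ρ) (2 * Z m) := by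
  have h1 : HasSum (zetaTerm m (1 / 4)) (Z m) := (summable_zetaTerm hm).hasSum
  rw [← (Equiv.ofBijective _ bijective_tau).hasSum_iff, two_mul]
  refine HasSum.sum ?_ ?_
  · convert h1 using 1
    ext τ
    exact (zetaTerm_natCast m τ).symm
  · convert h1 using 1
    ext τ
    exact (pairTerm_one_sub m τ.2.2).trans (zetaTerm_natCast m τ).symm

theorem tendsto_sum_pairTerm {m : ℕ} (hm : 1 ≤ m) :
    Tendsto (fun T => ∑ ρ ∈ zerosUpTo T, pairTerm m ρ) atTop (𝓝 (2 * Z m)) := by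
  rw [← (hasSum_pairTerm hm).tsum_eq]
  exact exhausts_zerosUpTo.tendsto_sum (summable_pairTerm hm)

theorem inv_add_inv_one_sub {ρ : ℂ} (h : ρ ∈ nontrivialZeros) :
    ρ⁻¹ + (1 - ρ)⁻¹ = ρ⁻¹ * (1 - ρ)⁻¹ := by
  have h0 := ne_zero_of_mem_nontrivialZeros h
  have h1 := one_sub_ne_zero_of_mem_nontrivialZeros h
  field_simp
  ring

theorem pairTerm_eq (m : ℕ) (ρ : ℂ) : pairTerm m ρ = (mult ρ : ℂ) * (ρ⁻¹ * (1 - ρ)⁻¹) ^ m := by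
  rw [pairTerm, ← mul_inv, inv_pow]

theorem sum_inv_pow_add_inv_pow (n : ℕ) (T : ℝ) :
    ∑ ρ ∈ zerosUpTo T, (mult ρ : ℂ) * (ρ⁻¹ ^ n + (1 - ρ)⁻¹ ^ n) = 2 * partialZ n T := by
  simp only [mul_add, Finset.sum_add_distrib]
  rw [exhausts_zerosUpTo.sum_mult_one_sub T fun ρ => ρ⁻¹ ^ n, partialZ, two_mul]
  simp only [inv_pow]

/-- The algebraic identity is summed over |Im ρ| ≤ T before T → ∞, since 𝒵_1 is only defined as such
a limit. Both sides are doubled because each pair is counted twice. -/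
theorem Z_eq_sum_scrZ {m : ℕ} (hm : 1 ≤ m) :
    Z m = ∑ l ∈ Finset.range m, ((m + l - 1).choose (m - 1) : ℂ) * scrZ (m - l) := by
  have h1 : Tendsto (fun T => ∑ l ∈ Finset.range m,
      ((m + l - 1).choose (m - 1) : ℂ) * (2 * partialZ (m - l) T)) atTop
      (𝓝 (∑ l ∈ Finset.range m, ((m + l - 1).choose (m - 1) : ℂ) * (2 * scrZ (m - l)))) := by
    refine tendsto_finsetSum _ fun l hl => ((tendsto_partialZ ?_).const_mul 2).const_mul _
    have := Finset.mem_range.1 hl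
    omega
  have h2 : (fun T => ∑ ρ ∈ zerosUpTo T, pairTerm m ρ) = fun T => ∑ l ∈ Finset.range m,
      ((m + l - 1).choose (m - 1) : ℂ) * (2 * partialZ (m - l) T) := by
    ext T
    simp only [← sum_inv_pow_add_inv_pow, Finset.mul_sum]
    rw [Finset.sum_comm]
    refine Finset.sum_congr rfl fun ρ hρ => ?_
    rw [pairTerm_eq, mul_pow_eq_sum_choose (inv_add_inv_one_sub (mem_zerosUpTo.1 hρ).1) hm,
      Finset.mul_sum]
    exact Finset.sum_congr rfl fun l _ => by ring
  have h3 := tendsto_sum_pairTerm hm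
  rw [h2] at h3
  have h4 := tendsto_nhds_unique h3 h1
  simp only [mul_left_comm _ (2 : ℂ), ← Finset.mul_sum] at h4
  exact mul_left_cancel₀ two_ne_zero h4

theorem scrZ_div_eq_sum_Z {n : ℕ} (hn : 1 ≤ n) :
    scrZ n / n = ∑ l ∈ Finset.range (n / 2 + 1),
      (-1) ^ l * ((n - l).choose l : ℂ) * (Z ((n - l : ℕ) : ℂ) / ((n - l : ℕ) : ℂ)) := by
  have h1 : Tendsto (fun T => ∑ l ∈ Finset.range (n / 2 + 1), (-1) ^ l * ((n - l).choose l : ℂ) *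
      ((∑ ρ ∈ zerosUpTo T, pairTerm (n - l) ρ) / ((n - l : ℕ) : ℂ))) atTop
      (𝓝 (∑ l ∈ Finset.range (n / 2 + 1), (-1) ^ l * ((n - l).choose l : ℂ) *
        ((2 * Z ((n - l : ℕ) : ℂ)) / ((n - l : ℕ) : ℂ)))) := by
    refine tendsto_finsetSum _ fun l hl =>
      ((tendsto_sum_pairTerm ?_).div_const _).const_mul _
    have := Finset.mem_range.1 hl
    omega
  have h2 : (fun T => 2 * partialZ n T / n) = fun T => ∑ l ∈ Finset.range (n / 2 + 1),
      (-1) ^ l * ((n - l).choose l : ℂ) *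
      ((∑ ρ ∈ zerosUpTo T, pairTerm (n - l) ρ) / ((n - l : ℕ) : ℂ)) := by
    ext T
    simp only [← sum_inv_pow_add_inv_pow, Finset.sum_div, Finset.mul_sum]
    rw [Finset.sum_comm]
    refine Finset.sum_congr rfl fun ρ hρ => ?_
    rw [mul_div_assoc, pow_add_pow_div_eq_sum (inv_add_inv_one_sub (mem_zerosUpTo.1 hρ).1) hn,
      Finset.mul_sum]
    exact Finset.sum_congr rfl fun l _ => by rw [pairTerm_eq]; ring
  have h3 := ((tendsto_partialZ hn).const_mul 2).div_const (n : ℂ)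
  rw [h2] at h3
  have h4 := tendsto_nhds_unique h3 h1
  simp only [mul_div_assoc, mul_left_comm _ (2 : ℂ), ← Finset.mul_sum] at h4
  exact mul_left_cancel₀ two_ne_zero h4

theorem Z_one : Z 1 = scrZ 1 := by
  have h := Z_eq_sum_scrZ (m := 1) le_rfl
  simpa using h

end TauSums

/-! ### Derivatives of ξ'/ξ at 0 and at 1. -/

section LogDerivXi

open Complex (Gamma Gammaℝ)

theorem xi_eq_mul_riemannZeta₁ {s : ℂ} (hs : 0 < s.re) :
    xi s = s * (Gammaℝ s * riemannZeta₁ s) := by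
  by_cases h1 : s = 1
  · simp [h1, xi_one]
  have h0 : s ≠ 0 := by
    rintro rfl
    simp at hs
  have h2 : s - 1 ≠ 0 := sub_ne_zero.2 h1
  have h3 := riemannZeta_eq_xi h0 h1
  have hG := Complex.Gammaℝ_ne_zero_of_re_pos hs
  rw [riemannZeta_eq_inv_sub_mul h1] at h3
  field_simp at h3
  linear_combination -h3

/-- The factor s of ξ cancels the pole of Γ_ℝ at 0: s Γ_ℝ(s) = 2 π^{-s/2} Γ(s/2 + 1), which is
regular and nonzero there. -/
theorem xi_eq_mul_riemannZeta {s : ℂ} (hs : -1 < s.re) (h1 : s ≠ 1) :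
    xi s = (s - 1) * ((2 * (Real.pi : ℂ) ^ (-1 / 2 * s + 0) * Gamma (1 / 2 * s + 1)) *
      riemannZeta s) := by
  by_cases h0 : s = 0
  · norm_num [h0, xi_zero, riemannZeta_zero]
  have h2 : s - 1 ≠ 0 := sub_ne_zero.2 h1
  have h3 := riemannZeta_eq_xi h0 h1
  have hG : Gammaℝ s ≠ 0 := by
    rw [Ne, Complex.Gammaℝ_eq_zero_iff]
    rintro ⟨n, rfl⟩
    rcases n with _ | n
    · simp at h0
    · simp at hs
      linarith
  have h4 : Gammaℝ s * s = 2 * (Real.pi : ℂ) ^ (-1 / 2 * s + 0) * Gamma (1 / 2 * s + 1) := by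
    rw [Complex.Gamma_add_one _ (by simpa using h0), Complex.Gammaℝ_def,
      show -s / 2 = -1 / 2 * s + 0 by ring, show s / 2 = 1 / 2 * s by ring]
    ring
  rw [← h4, h3]
  field_simp

theorem analyticAt_const_mul_pi_cpow (b z : ℂ) :
    AnalyticAt ℂ (fun s : ℂ => b * (Real.pi : ℂ) ^ (-1 / 2 * s + 0)) z :=
  analyticAt_const.mul (Differentiable.analyticAt (fun s => by
    exact DifferentiableAt.const_cpow (by fun_prop)
      (Or.inl (Complex.ofReal_ne_zero.2 Real.pi_ne_zero))) _)

theorem const_mul_pi_cpow_ne_zero {b : ℂ} (hb : b ≠ 0) (z : ℂ) :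
    b * (Real.pi : ℂ) ^ (-1 / 2 * z + 0) ≠ 0 :=
  mul_ne_zero hb (by simp [Complex.cpow_eq_zero_iff])

theorem analyticAt_Gamma_half_mul_add {a z : ℂ} (h : 0 < (1 / 2 * z + a).re) :
    AnalyticAt ℂ (fun s : ℂ => Gamma (1 / 2 * s + a)) z :=
  AnalyticAt.fun_comp (f := fun s : ℂ => 1 / 2 * s + a) (analyticAt_Gamma_of_re_pos h) (by fun_prop)

theorem Gammaℝ_eq :
    Gammaℝ = fun s => (1 * (Real.pi : ℂ) ^ (-1 / 2 * s + 0)) * Gamma (1 / 2 * s + 0) := by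
  ext s
  rw [Complex.Gammaℝ_def, one_mul, show -s / 2 = -1 / 2 * s + 0 by ring,
    show s / 2 = 1 / 2 * s + 0 by ring]

theorem analyticAt_Gammaℝ_one : AnalyticAt ℂ Gammaℝ 1 := by
  rw [Gammaℝ_eq]
  exact (analyticAt_const_mul_pi_cpow 1 1).mul (analyticAt_Gamma_half_mul_add (by norm_num))

theorem iteratedDeriv_logDeriv_sub (k : ℕ) (a z : ℂ) :
    iteratedDeriv k (logDeriv fun w => w - a) z =
      (-1) ^ k * k.factorial * ((z - a) ^ (k + 1))⁻¹ := by
  rw [← iteratedDeriv_sub_inv]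
  congr 1
  ext w
  simp [logDeriv_apply]

theorem iteratedDeriv_congr_logDeriv {f g : ℂ → ℂ} {z : ℂ} (h : f =ᶠ[𝓝 z] g) (k : ℕ) :
    iteratedDeriv k (logDeriv f) z = iteratedDeriv k (logDeriv g) z := by
  refine EventuallyEq.iteratedDeriv_eq k ?_
  filter_upwards [h, h.deriv] with w h1 h2
  rw [logDeriv_apply, logDeriv_apply, h1, h2]

theorem iteratedDeriv_logDeriv_xi_zero (k : ℕ) :
    iteratedDeriv k (logDeriv xi) 0 = (-1) ^ (k + 1) * iteratedDeriv k (logDeriv xi) 1 := by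
  have h := iteratedDeriv_logDeriv_comp_affine (f := xi) (a := -1) (b := 1) (z := 0) k
    (differentiable_xi.analyticAt _) (by simp [xi_one])
  have e : (fun w => xi (-1 * w + 1)) = xi := by
    ext w
    rw [← xi_one_sub]
    ring_nf
  rwa [e, mul_zero, zero_add] at h

theorem iteratedDeriv_logDeriv_xi_one (k : ℕ) :
    iteratedDeriv k (logDeriv xi) 1 = (-1) ^ k * k.factorial +
      (iteratedDeriv k (logDeriv Gammaℝ) 1 + iteratedDeriv k (logDeriv riemannZeta₁) 1) := by
  have hz : AnalyticAt ℂ riemannZeta₁ 1 := differentiable_riemannZeta₁.analyticAt 1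
  have h : xi =ᶠ[𝓝 1] fun s => (s - 0) * (Gammaℝ s * riemannZeta₁ s) := by
    filter_upwards [(isOpen_lt continuous_const Complex.continuous_re).mem_nhds
      (show (0 : ℝ) < (1 : ℂ).re by simp)] with s hs
    rw [sub_zero, xi_eq_mul_riemannZeta₁ hs]
  rw [iteratedDeriv_congr_logDeriv h, iteratedDeriv_logDeriv_mul (by fun_prop)
    (analyticAt_Gammaℝ_one.fun_mul hz) (by simp) (by simp), iteratedDeriv_logDeriv_mul
    analyticAt_Gammaℝ_one hz (by simp) (by simp), iteratedDeriv_logDeriv_sub]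
  simp

/-- The scaling s/2 contributes 2^{-(k+1)}, which turns the factor 2^{k+1} - 1 of the value at 1/2
into 1 - 2^{-(k+1)}. -/
theorem iteratedDeriv_logDeriv_Gammaℝ_one {k : ℕ} (hk : 1 ≤ k) :
    iteratedDeriv k (logDeriv Gammaℝ) 1 =
      (1 - (2 ^ (k + 1))⁻¹) * ((-1) ^ (k + 1) * k.factorial * riemannZeta ((k + 1 : ℕ) : ℂ)) := by
  have h1 : (0 : ℝ) < ((1 / 2 : ℂ) * 1 + 0).re := by norm_num
  rw [Gammaℝ_eq, iteratedDeriv_logDeriv_mul (analyticAt_const_mul_pi_cpow 1 1)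
    (analyticAt_Gamma_half_mul_add h1) (const_mul_pi_cpow_ne_zero one_ne_zero 1)
    (Complex.Gamma_ne_zero_of_re_pos h1), iteratedDeriv_logDeriv_cpow hk
    (Complex.ofReal_ne_zero.2 Real.pi_ne_zero) one_ne_zero, iteratedDeriv_logDeriv_comp_affine k
    (analyticAt_Gamma_of_re_pos h1) (Complex.Gamma_ne_zero_of_re_pos h1), mul_one, add_zero,
    iteratedDeriv_logDeriv_Gamma_one_half hk, one_div, inv_pow]
  have : (2 : ℂ) ^ (k + 1) ≠ 0 := pow_ne_zero _ two_ne_zero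
  field_simp
  ring

theorem scrZ_succ_eq_stieltjesCumulant {k : ℕ} (hk : 1 ≤ k) :
    scrZ (k + 1) = 1 - (1 - (2 ^ (k + 1))⁻¹) * riemannZeta ((k + 1 : ℕ) : ℂ) +
      ((k : ℂ) + 1) / k.factorial * (stieltjesCumulant k : ℂ) := by
  have hf : (k.factorial : ℂ) ≠ 0 := Nat.cast_ne_zero.2 k.factorial_ne_zero
  have hs : ((-1 : ℂ) ^ k) * (-1) ^ k = 1 := by rw [← mul_pow]; simp
  rw [scrZ_succ, iteratedDeriv_logDeriv_xi_zero, iteratedDeriv_logDeriv_xi_one,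
    iteratedDeriv_logDeriv_Gammaℝ_one hk, iteratedDeriv_logDeriv_riemannZeta₁, pow_succ (-1 : ℂ)]
  generalize riemannZeta ((k + 1 : ℕ) : ℂ) = ζ
  generalize ((2 : ℂ) ^ (k + 1))⁻¹ = q
  rw [← sub_eq_zero]
  field_simp
  linear_combination (k.factorial * (1 - (1 - q) * ζ) + (k + 1) * (stieltjesCumulant k : ℂ)) * hs

theorem iteratedDeriv_logDeriv_xi_zero_eq {k : ℕ} (hk : 1 ≤ k) :
    iteratedDeriv k (logDeriv xi) 0 = -(k.factorial : ℂ) +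
      ((2 ^ (k + 1))⁻¹ * ((-1) ^ (k + 1) * k.factorial * riemannZeta ((k + 1 : ℕ) : ℂ)) +
        iteratedDeriv k (logDeriv riemannZeta) 0) := by
  have h1 : (0 : ℝ) < ((1 / 2 : ℂ) * 0 + 1).re := by norm_num
  have hz : AnalyticAt ℂ riemannZeta 0 :=
    analyticOn_riemannZeta 0 (by simp)
  have hz0 : riemannZeta 0 ≠ 0 := by norm_num [riemannZeta_zero]
  have hG := Complex.Gamma_ne_zero_of_re_pos h1
  have hp := const_mul_pi_cpow_ne_zero two_ne_zero 0
  have h : xi =ᶠ[𝓝 0] fun s => (s - 1) * ((2 * (Real.pi : ℂ) ^ (-1 / 2 * s + 0) *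
      Gamma (1 / 2 * s + 1)) * riemannZeta s) := by
    filter_upwards [(isOpen_lt continuous_const Complex.continuous_re).mem_nhds
      (show (-1 : ℝ) < (0 : ℂ).re by simp), eventually_ne_nhds zero_ne_one] with s hs h1
    exact xi_eq_mul_riemannZeta hs h1
  have hA := (analyticAt_const_mul_pi_cpow 2 0).fun_mul (analyticAt_Gamma_half_mul_add h1)
  rw [iteratedDeriv_congr_logDeriv h, iteratedDeriv_logDeriv_mul (by fun_prop)
    (hA.fun_mul hz) (by simp) (mul_ne_zero (mul_ne_zero hp hG) hz0),
    iteratedDeriv_logDeriv_mul hA hz (mul_ne_zero hp hG) hz0,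
    iteratedDeriv_logDeriv_mul (analyticAt_const_mul_pi_cpow 2 0)
      (analyticAt_Gamma_half_mul_add h1) hp hG,
    iteratedDeriv_logDeriv_cpow hk (Complex.ofReal_ne_zero.2 Real.pi_ne_zero) two_ne_zero,
    iteratedDeriv_logDeriv_comp_affine k (analyticAt_Gamma_of_re_pos h1) hG, mul_zero, zero_add,
    zero_add,
    iteratedDeriv_logDeriv_Gamma_one hk, iteratedDeriv_logDeriv_sub, one_div, inv_pow, zero_sub,
    pow_succ (-1 : ℂ)]
  have hs : ((-1 : ℂ) ^ k) * ((-1) ^ k)⁻¹ = 1 := mul_inv_cancel₀ (by simp)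
  rw [mul_inv]
  norm_num
  linear_combination (k.factorial : ℂ) * hs

end LogDerivXi

/-! ### The real function log |ζ(x)|, and the value 𝒵_1. -/

section RealLogDeriv

theorem iteratedDeriv_conj {G : ℂ → ℂ}
    (hG : ∀ s, G ((starRingEnd ℂ) s) = (starRingEnd ℂ) (G s)) (k : ℕ) (s : ℂ) :
    iteratedDeriv k G ((starRingEnd ℂ) s) = (starRingEnd ℂ) (iteratedDeriv k G s) := by
  induction k generalizing s with
  | zero => simpa using hG s
  | succ k ih =>
    rw [iteratedDeriv_succ]
    have e : iteratedDeriv k G = starRingEnd ℂ ∘ iteratedDeriv k G ∘ starRingEnd ℂ := by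
      ext s
      simp [ih]
    have h := congrFun (deriv_conj_conj (f := iteratedDeriv k G)) ((starRingEnd ℂ) s)
    rw [← e] at h
    simpa using h

theorem iteratedDeriv_ofReal_re {G : ℂ → ℂ} {x : ℝ} (hG : AnalyticAt ℂ G x) (k : ℕ) :
    iteratedDeriv k (fun y : ℝ => (G y).re) x = (iteratedDeriv k G x).re := by
  induction k generalizing x with
  | zero => simp
  | succ k ih =>
    have h1 : iteratedDeriv k (fun y : ℝ => (G y).re) =ᶠ[𝓝 x]
        fun y : ℝ => (iteratedDeriv k G y).re := by
      filter_upwards [Complex.continuous_ofReal.continuousAt.eventually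
        hG.eventually_analyticAt] with y hy using ih hy
    have h2 : HasDerivAt (iteratedDeriv k G) (deriv (iteratedDeriv k G) x) x := by
      have := hG.iterated_deriv k
      rw [← iteratedDeriv_eq_iterate] at this
      exact this.differentiableAt.hasDerivAt
    rw [iteratedDeriv_succ, h1.deriv_eq, h2.real_of_complex.deriv, iteratedDeriv_succ]

theorem deriv_log_norm_riemannZeta {x : ℝ} (h1 : x ≠ 1) (h0 : riemannZeta x ≠ 0) :
    deriv (fun x : ℝ => Real.log ‖riemannZeta x‖) x = (logDeriv riemannZeta x).re := by
  have him : ∀ y : ℝ, riemannZeta y = ((riemannZeta y).re : ℂ) := fun y => by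
    refine (Complex.conj_eq_iff_re.1 ?_).symm
    rw [← riemannZeta_conj, Complex.conj_ofReal]
  have e : (fun x : ℝ => Real.log ‖riemannZeta x‖) = fun x : ℝ => Real.log (riemannZeta x).re := by
    ext y
    rw [him y, Complex.norm_real, Real.norm_eq_abs, Real.log_abs, Complex.ofReal_re]
  have hd := (differentiableAt_riemannZeta (by exact_mod_cast h1 : (x : ℂ) ≠ 1)).hasDerivAt
  have hre : (riemannZeta x).re ≠ 0 := fun h => h0 (by rw [him x, h, Complex.ofReal_zero])
  rw [e, (hd.real_of_complex.log hre).deriv, logDeriv_apply, ← Complex.div_ofReal_re, ← him x]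

/-- Near 0 on the real line, the derivative of log |ζ| is Re(ζ'/ζ). As ζ'/ζ commutes with
conjugation, its derivatives at 0 are real and the real part can be dropped. -/
theorem iteratedDeriv_log_norm_riemannZeta (k : ℕ) :
    ((iteratedDeriv (k + 1) (fun x : ℝ => Real.log ‖riemannZeta x‖) 0 : ℝ) : ℂ) =
      iteratedDeriv k (logDeriv riemannZeta) 0 := by
  have hA : AnalyticAt ℂ (logDeriv riemannZeta) ((0 : ℝ) : ℂ) := by
    rw [Complex.ofReal_zero]
    exact analyticAt_logDeriv (analyticOn_riemannZeta 0 (by simp)) (by norm_num [riemannZeta_zero])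
  have h1 : deriv (fun x : ℝ => Real.log ‖riemannZeta x‖) =ᶠ[𝓝 0]
      fun x : ℝ => (logDeriv riemannZeta x).re := by
    have hc : ContinuousAt (fun x : ℝ => riemannZeta x) 0 :=
      ContinuousAt.comp (f := fun x : ℝ => (x : ℂ)) (g := riemannZeta)
        (differentiableAt_riemannZeta (by simp)).continuousAt Complex.continuous_ofReal.continuousAt
    filter_upwards [eventually_ne_nhds zero_ne_one,
      hc.eventually_ne (show riemannZeta (0 : ℝ) ≠ 0 by norm_num [riemannZeta_zero])] with x hx hx0
    exact deriv_log_norm_riemannZeta hx hx0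
  have hconj : ∀ s, logDeriv riemannZeta ((starRingEnd ℂ) s) =
      (starRingEnd ℂ) (logDeriv riemannZeta s) := fun s => by
    have h := iteratedDeriv_conj riemannZeta_conj 1 s
    rw [iteratedDeriv_one] at h
    rw [logDeriv_apply, logDeriv_apply, map_div₀, riemannZeta_conj, h]
  have h2 := iteratedDeriv_conj hconj k 0
  rw [map_zero] at h2
  rw [iteratedDeriv_succ', h1.iteratedDeriv_eq, iteratedDeriv_ofReal_re hA, Complex.ofReal_zero]
  exact Complex.conj_eq_iff_re.1 h2.symm

theorem scrZ_succ_eq_log_riemannZeta {k : ℕ} (hk : 1 ≤ k) :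
    scrZ (k + 1) = 1 - (-1) ^ (k + 1) * (2 ^ (k + 1))⁻¹ * riemannZeta ((k + 1 : ℕ) : ℂ) -
      ((iteratedDeriv (k + 1) (fun x : ℝ => Real.log ‖riemannZeta x‖) 0 : ℝ) : ℂ) /
        k.factorial := by
  have hf : (k.factorial : ℂ) ≠ 0 := Nat.cast_ne_zero.2 k.factorial_ne_zero
  rw [scrZ_succ, iteratedDeriv_logDeriv_xi_zero_eq hk, iteratedDeriv_log_norm_riemannZeta]
  generalize ((2 : ℂ) ^ (k + 1))⁻¹ = q
  field_simp
  ring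

/-- By reflection 𝒵_1 = (ξ'/ξ)(1). The factors s, Γ_ℝ and (s-1)ζ(s) contribute 1, -(γ + log 4π)/2
and γ, and log 4π = 2 log(2√π). -/
theorem scrZ_one : scrZ 1 =
    ((1 + Real.eulerMascheroniConstant / 2 - Real.log (2 * Real.sqrt Real.pi) : ℝ) : ℂ) := by
  have hlog : Complex.log (4 * (Real.pi : ℂ)) = ((2 * Real.log (2 * √Real.pi) : ℝ) : ℂ) := by
    have e : (4 * Real.pi : ℝ) = (2 * √Real.pi) ^ 2 := by
      rw [mul_pow, Real.sq_sqrt Real.pi_pos.le]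
      norm_num
    have h4 : (0 : ℝ) ≤ 4 * Real.pi := by positivity
    have e2 : (4 * (Real.pi : ℂ)) = ((4 * Real.pi : ℝ) : ℂ) := by push_cast; rfl
    rw [e2, ← Complex.ofReal_log h4, e, Real.log_pow]
    norm_num
  have h := scrZ_succ 0
  rw [iteratedDeriv_logDeriv_xi_zero, iteratedDeriv_logDeriv_xi_one] at h
  simp only [iteratedDeriv_zero, logDeriv_apply, Complex.hasDerivAt_Gammaℝ_one.deriv,
    Complex.Gammaℝ_one, deriv_riemannZeta₁_one, riemannZeta₁_one, hlog] at h
  norm_num at h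
  rw [h]
  push_cast
  ring

end RealLogDeriv

end RiemannZeros

theorem mainTheorem7 :
    -- the series and limits that define `𝒵_n`, `Z(m)` and `γ_n` converge
    (∀ n : ℕ, 1 ≤ n →
      Tendsto (RiemannZeros.partialZ n) atTop (𝓝 (RiemannZeros.scrZ n))) ∧
    (∀ n : ℕ, 2 ≤ n →
      HasSum (fun ρ : RiemannZeros.nontrivialZeros =>
        (RiemannZeros.mult (ρ : ℂ) : ℂ) * ((ρ : ℂ) ^ n)⁻¹) (RiemannZeros.scrZ n)) ∧
    (∀ m : ℕ, 1 ≤ m →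
      Summable (RiemannZeros.zetaTerm (m : ℂ) (1 / 4))) ∧
    (∀ n : ℕ,
      Tendsto (RiemannZeros.stieltjesSeq n) atTop (𝓝 (RiemannZeros.stieltjes n))) ∧
    -- `Z(m)` in terms of the `𝒵_n`
    (∀ m : ℕ, 1 ≤ m →
      RiemannZeros.Z (m : ℂ) =
        ∑ l ∈ Finset.range m,
          (Nat.choose (m + l - 1) (m - 1) : ℂ) * RiemannZeros.scrZ (m - l)) ∧
    -- `𝒵_n` in terms of the `Z(m)`
    (∀ n : ℕ, 1 ≤ n →
      RiemannZeros.scrZ n / (n : ℂ) =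
        ∑ l ∈ Finset.range (n / 2 + 1),
          (-1 : ℂ) ^ l * (Nat.choose (n - l) l : ℂ) *
            (RiemannZeros.Z ((n - l : ℕ) : ℂ) / ((n - l : ℕ) : ℂ))) ∧
    -- the two expressions of `𝒵_n` for `n ≥ 2`
    (∀ n : ℕ, 2 ≤ n →
      RiemannZeros.scrZ n =
          1 - (-1 : ℂ) ^ n * (2 ^ n)⁻¹ * riemannZeta (n : ℂ) -
            ((iteratedDeriv n (fun x : ℝ => Real.log ‖riemannZeta (x : ℂ)‖) 0 : ℝ) : ℂ) /
              ((n - 1).factorial : ℂ) ∧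
      RiemannZeros.scrZ n =
          1 - (1 - (2 ^ n)⁻¹) * riemannZeta (n : ℂ) +
            (n : ℂ) / ((n - 1).factorial : ℂ) *
              ((RiemannZeros.stieltjesCumulant (n - 1) : ℝ) : ℂ)) ∧
    -- the value at `1`
    RiemannZeros.Z 1 = RiemannZeros.scrZ 1 ∧
    RiemannZeros.scrZ 1 =
      ((1 + Real.eulerMascheroniConstant / 2 - Real.log (2 * Real.sqrt Real.pi) : ℝ) : ℂ) := by
  open RiemannZeros in
  refine ⟨fun n hn => tendsto_partialZ hn, fun n hn => hasSum_scrZ hn,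
    fun m hm => summable_zetaTerm hm, tendsto_stieltjesSeq, fun m hm => Z_eq_sum_scrZ hm,
    fun n hn => scrZ_div_eq_sum_Z hn, fun n hn => ?_, Z_one, scrZ_one⟩
  obtain ⟨k, rfl⟩ := Nat.exists_eq_add_of_le' (show 1 ≤ n by omega)
  have hk : 1 ≤ k := by omega
  refine ⟨RiemannZeros.scrZ_succ_eq_log_riemannZeta hk, ?_⟩
  simpa using RiemannZeros.scrZ_succ_eq_stieltjesCumulant hk
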